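/- Notation. Let $u_t=(\cos t,\sin t)$, $v_t=(-\sin t,\cos t)$, let $R_t$ be the counterclockwise rotation of $\mathbb{R}^2$ about the origin by the angle $t$, and let $|X|$ denote area. The hallway is $L=H_L\cup V_L$ with $H_L=(-\infty,1]\times[0,1]$ and $V_L=[0,1]\times(-\infty,1]$. A *moving sofa with rotation angle $\alpha$* is a nonempty, connected, closed set $S\subseteq\mathbb{R}^2$ for which there is a continuous curve of orientation-preserving rigid motions $\Phi_s$, $s\in[0,1]$, such that $\Phi_0$ is a translation, $\Phi_0(S)\subseteq H_L$, $\Phi_s(S)\subseteq L$ for all $s$, $\Phi_1(S)\subseteq V_L$, and the total clockwise angle of rotation along the curve is $\alpha$. For $X\subseteq\mathbb{R}^2$ nonempty and compact, let $h_X(t)=\sup_{p\in X}p\cdot u_t$ and $f_{X,t}(p)=R_t(p)+(h_X(t)-1)u_t+(h_X(t+\pi/2)-1)v_t$; put $L_X(t)=f_{X,t}(L)$, $Q_X^+(t)=f_{X,t}((-\infty,1]^2)$, $Q_X^-(t)=f_{X,t}((-\infty,0)^2)$. For $\omega\in(0,\pi/2]$ let $$P_\omega=(\mathbb{R}\times[0,1])\cap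 R_\omega([0,1]\times\mathbb{R}),\qquad F_\omega=\{p: p\cdot u_\omega\ge 0,\ p\cdot u_{\pi/2}\ge0\},\qquad o_\omega=(\tan(\pi/4-\omega/2),1).$$ A moving sofa $S'$ with rotation angle $\omega$ is in *standard position* if $h_{S'}(\omega)=h_{S'}(\pi/2)=1$. A *monotone sofa* with rotation angle $\omega$ is a set of the form $P_\omega\cap\bigcap_{t\in[0,\omega]}L_{S'}(t)$ with $S'$ a moving sofa with rotation angle $\omega$ in standard position. The *cap* of a monotone sofa $S$ is $\mathcal{C}(S)=P_\omega\cap\bigcap_{t\in[0,\omega]}Q_S^+(t)$. A *cap with rotation angle $\omega$* is a nonempty compact convex set $K$ with $h_K(\omega)=h_K(\pi/2)=1$, $h_K(\omega+\pi)=h_K(3\pi/2)=0$ that is an intersection of closed half-planes with normal angles in $[0,\omega]\cup[\pi/2,\omega+\pi/2]\cup\{\omega+\pi,3\pi/2\}$. Its *niche* is $\mathcal{N}(K)=F_\omega\cap\bigcup_{t\in(0,\omega)}Q_K^-(t)$. For a nonempty finite set $\Theta\subset(0,\omega)$, a *polygon cap with angle set $\Theta$* is a cap with rotation angle $\omega$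 that is an intersection of closed half-planes with normal angles in $\Theta\cup(\Theta+\pi/2)\cup\{\omega,\pi/2,\omega+\pi,3\pi/2\}$; put $\mathcal{C}_\Theta(K)=P_\omega\cap\bigcap_{t\in\Theta}Q_K^+(t)$, $\mathcal{N}_\Theta(K)=F_\omega\cap\bigcup_{t\in\Theta}Q_K^-(t)$ and $\mathcal{A}_\Theta(K)=|\mathcal{C}_\Theta(K)|-|\mathcal{N}_\Theta(K)|$. A *maximum polygon cap* with angle set $\Theta$ is a polygon cap $K$ with angle set $\Theta$ that contains $o_\omega$ and maximizes $\mathcal{A}_\Theta$ over all polygon caps with angle set $\Theta$. A *balanced maximum cap* with rotation angle $\omega$ is a cap $K_\omega$ with rotation angle $\omega$ that is the limit in Hausdorff distance of a sequence of maximum polygon caps $K_i$ with angle sets $\{j\omega/n_i:1\le j<n_i\}$, where $1<n_1<n_2<\cdots$ are powers of two. A *balanced maximum sofa* with rotation angle $\omega$ is a monotone sofa with rotation angle $\omega$ whose cap is a balanced maximum cap with rotation angle $\omega$. Theorem. Let $\omega\in[\sec^{-1}(2.2),\pi/2]$ and let $S_\omega$ be any balanced maximum sofa with rotation angle $\omega$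 and area $|S_\omega|\ge 2.2$. Then some rotated copy $R_\varphi(S_\omega)$, $\varphi\in\mathbb{R}$, is a moving sofa with rotation angle $\pi/2$. Moreover, if $\omega<\pi/2$, then the closed triangle $\Delta_\omega$ with vertices $(0,0)$, $o_\omega-(0,1)$ and $o_\omega-(\cos\omega,\sin\omega)$ is contained in the niche $\mathcal{N}(\mathcal{C}(S_\omega))$ of the cap of $S_\omega$. -/

import Mathlib

open Set Filter Topology MeasureTheory

noncomputable section

namespace MovingSofa

/-- The Euclidean plane. -/
abbrev Plane : Type := EuclideanSpace ℝ (Fin 2)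

/-- The unit vector `u_t = (cos t, sin t)`. -/
def u (t : ℝ) : Plane := !₂[Real.cos t, Real.sin t]

/-- The unit vector `v_t = (-sin t, cos t)`. -/
def v (t : ℝ) : Plane := !₂[-Real.sin t, Real.cos t]

/-- Rotation of the plane about the origin by the counterclockwise angle `t`. -/
def rot (t : ℝ) (p : Plane) : Plane :=
  !₂[Real.cos t * p 0 - Real.sin t * p 1, Real.sin t * p 0 + Real.cos t * p 1]

/-! ### The hallway and moving sofas -/

/-- The horizontal side `(-∞, 1] × [0, 1]` of the hallway. -/
def horizontalSide : Set Plane := {p | p 0 ≤ 1 ∧ 0 ≤ p 1 ∧ p 1 ≤ 1}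

/-- The vertical side `[0, 1] × (-∞, 1]` of the hallway. -/
def verticalSide : Set Plane := {p | 0 ≤ p 0 ∧ p 0 ≤ 1 ∧ p 1 ≤ 1}

/-- The hallway `L`. -/
def hallway : Set Plane := horizontalSide ∪ verticalSide

/-- `S` can be moved inside the hallway from its horizontal to its vertical side by a continuous
rigid motion `Φ_s(p) = R_{θ(s)}(p) + c(s)`, `s ∈ [0, 1]`, with `Φ_0` a translation, that rotates `S`
clockwise by the total angle `α`. A continuous curve in `SE(2)` starting at a translation is the
same thing as a pair of continuous curves `θ`, `c` with `θ(0) = 0`. -/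
def AdmitsMovement (S : Set Plane) (α : ℝ) : Prop :=
  ∃ (θ : unitInterval → ℝ) (c : unitInterval → Plane),
    Continuous θ ∧ Continuous c ∧ θ 0 = 0 ∧ θ 1 = -α ∧
    (fun p => rot (θ 0) p + c 0) '' S ⊆ horizontalSide ∧
    (∀ s, (fun p => rot (θ s) p + c s) '' S ⊆ hallway) ∧
    (fun p => rot (θ 1) p + c 1) '' S ⊆ verticalSide

/-- `S` is a moving sofa (in an arbitrary translated position) with rotation angle `α`.
Here `IsConnected` includes non-emptiness. -/
def IsMovingSofa (S : Set Plane) (α : ℝ) : Prop :=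
  IsConnected S ∧ IsClosed S ∧ AdmitsMovement S α

/-! ### Support functions and supporting hallways -/

/-- The support function `h_S(t) = sup {s ⋅ u_t : s ∈ S}`. -/
def support (S : Set Plane) (t : ℝ) : ℝ := sSup ((fun p : Plane => inner ℝ p (u t)) '' S)

/-- The closed half-plane `H_-(t, h) = {p : p ⋅ u_t ≤ h}` with normal angle `t`. -/
def halfPlane (t h : ℝ) : Set Plane := {p | inner ℝ p (u t) ≤ h}

/-- The rigid motion `f_{S,t}` taking `L` to the supporting hallway of `S` with angle `t`. -/
def hallwayMap (S : Set Plane) (t : ℝ) (p : Plane) : Plane :=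
  rot t p + (support S t - 1) • u t + (support S (t + Real.pi / 2) - 1) • v t

/-- The supporting hallway `L_S(t)`. -/
def supportingHallway (S : Set Plane) (t : ℝ) : Set Plane := hallwayMap S t '' hallway

/-- `Q⁺_S(t)`, the closed quadrant bounded by the outer walls of `L_S(t)`. -/
def outerQuadrant (S : Set Plane) (t : ℝ) : Set Plane :=
  hallwayMap S t '' {p | p 0 ≤ 1 ∧ p 1 ≤ 1}

/-- `Q⁻_S(t)`, the open quadrant bounded by the inner walls of `L_S(t)`. -/
def innerQuadrant (S : Set Plane) (t : ℝ) : Set Plane :=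
  hallwayMap S t '' {p | p 0 < 0 ∧ p 1 < 0}

/-! ### Monotone sofas -/

/-- The horizontal strip `H = ℝ × [0, 1]`. -/
def hStrip : Set Plane := {p | 0 ≤ p 1 ∧ p 1 ≤ 1}

/-- The vertical strip `V = [0, 1] × ℝ`. -/
def vStrip : Set Plane := {p | 0 ≤ p 0 ∧ p 0 ≤ 1}

/-- The parallelogram `P_ω = H ∩ R_ω(V)`. -/
def parallelogram (ω : ℝ) : Set Plane := hStrip ∩ rot ω '' vStrip

/-- The vertex `o_ω` of `P_ω`. -/
def upperVertex (ω : ℝ) : Plane := !₂[Real.tan (Real.pi / 4 - ω / 2), 1]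

/-- The fan `F_ω = {p : p ⋅ u_ω ≥ 0, p ⋅ u_{π/2} ≥ 0}`. -/
def fan (ω : ℝ) : Set Plane :=
  {p | 0 ≤ inner ℝ p (u ω) ∧ 0 ≤ inner ℝ p (u (Real.pi / 2))}

/-- Standard position for the rotation angle `ω`. -/
def IsStandardPosition (ω : ℝ) (S : Set Plane) : Prop :=
  support S ω = 1 ∧ support S (Real.pi / 2) = 1

/-- The intersection `𝓘(S) = P_ω ∩ ⋂_{t ∈ [0, ω]} L_S(t)`. -/
def monotonization (ω : ℝ) (S : Set Plane) : Set Plane :=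
  parallelogram ω ∩ ⋂ t ∈ Icc 0 ω, supportingHallway S t

/-- A monotone sofa with rotation angle `ω`. -/
def IsMonotoneSofa (ω : ℝ) (S : Set Plane) : Prop :=
  ∃ S' : Set Plane, IsMovingSofa S' ω ∧ IsStandardPosition ω S' ∧ S = monotonization ω S'

/-- The cap `𝓒(S) = P_ω ∩ ⋂_{t ∈ [0, ω]} Q⁺_S(t)` of a moving sofa `S`. -/
def capOf (ω : ℝ) (S : Set Plane) : Set Plane :=
  parallelogram ω ∩ ⋂ t ∈ Icc 0 ω, outerQuadrant S t

/-! ### Caps and niches -/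

/-- `K` is an intersection of closed half-planes whose normal angles lie in `A`. -/
def IsHalfPlaneIntersection (A : Set ℝ) (K : Set Plane) : Prop :=
  ∃ I : Set (ℝ × ℝ), (∀ i ∈ I, i.1 ∈ A) ∧ K = ⋂ i ∈ I, halfPlane i.1 i.2

/-- A cap with rotation angle `ω`. -/
def IsCap (ω : ℝ) (K : Set Plane) : Prop :=
  K.Nonempty ∧ IsCompact K ∧ Convex ℝ K ∧
  support K ω = 1 ∧ support K (Real.pi / 2) = 1 ∧
  support K (ω + Real.pi) = 0 ∧ support K (3 * Real.pi / 2) = 0 ∧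
  IsHalfPlaneIntersection
    (Icc 0 ω ∪ Icc (Real.pi / 2) (ω + Real.pi / 2) ∪ {ω + Real.pi, 3 * Real.pi / 2}) K

/-- The niche `𝓝(K) = F_ω ∩ ⋃_{t ∈ (0, ω)} Q⁻_K(t)` of a cap. -/
def niche (ω : ℝ) (K : Set Plane) : Set Plane :=
  fan ω ∩ ⋃ t ∈ Ioo 0 ω, innerQuadrant K t

/-! ### Polygon caps -/

/-- A polygon cap with rotation angle `ω` and angle set `Θ`: a cap that is an intersection of closed
half-planes with normal angles in `Θ ∪ (Θ + π/2) ∪ {ω, π/2} ∪ {ω + π, 3π/2}`. -/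
def IsPolygonCap (ω : ℝ) (Θ : Finset ℝ) (K : Set Plane) : Prop :=
  IsCap ω K ∧
  IsHalfPlaneIntersection
    ((Θ : Set ℝ) ∪ (fun t => t + Real.pi / 2) '' (Θ : Set ℝ) ∪ {ω, Real.pi / 2} ∪
      {ω + Real.pi, 3 * Real.pi / 2}) K

/-- `𝓒_Θ(K) = P_ω ∩ ⋂_{t ∈ Θ} Q⁺_K(t)`. -/
def polygonCap (ω : ℝ) (Θ : Finset ℝ) (K : Set Plane) : Set Plane :=
  parallelogram ω ∩ ⋂ t ∈ Θ, outerQuadrant K t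

/-- The polygon niche `𝓝_Θ(K) = F_ω ∩ ⋃_{t ∈ Θ} Q⁻_K(t)`. -/
def polygonNiche (ω : ℝ) (Θ : Finset ℝ) (K : Set Plane) : Set Plane :=
  fan ω ∩ ⋃ t ∈ Θ, innerQuadrant K t

/-- The polygon sofa area functional `𝓐_Θ(K) = |𝓒_Θ(K)| - |𝓝_Θ(K)|`. -/
def polygonArea (ω : ℝ) (Θ : Finset ℝ) (K : Set Plane) : ℝ :=
  volume.real (polygonCap ω Θ K) - volume.real (polygonNiche ω Θ K)

/-- A maximum polygon cap with rotation angle `ω` and angle set `Θ`. -/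
def IsMaximumPolygonCap (ω : ℝ) (Θ : Finset ℝ) (K : Set Plane) : Prop :=
  IsPolygonCap ω Θ K ∧ upperVertex ω ∈ K ∧
  ∀ K' : Set Plane, IsPolygonCap ω Θ K' → polygonArea ω Θ K' ≤ polygonArea ω Θ K

/-! ### Balanced maximum sofas -/

/-- The uniform angle set `{(i / n) ω : 1 ≤ i < n}`. -/
def uniformAngleSet (ω : ℝ) (n : ℕ) : Finset ℝ :=
  (Finset.Ico 1 n).image fun i : ℕ => (i : ℝ) / (n : ℝ) * ω

/-- A balanced maximum cap with rotation angle `ω`: a limit in Hausdorff distance of maximum polygon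
caps with uniform angle sets of `n_i` intervals, for a strictly increasing sequence of powers of two
`n_i > 1`. -/
def IsBalancedMaximumCap (ω : ℝ) (K : Set Plane) : Prop :=
  IsCap ω K ∧
  ∃ (n : ℕ → ℕ) (P : ℕ → Set Plane),
    StrictMono n ∧ (∀ i, 1 < n i ∧ ∃ k : ℕ, n i = 2 ^ k) ∧
    (∀ i, IsMaximumPolygonCap ω (uniformAngleSet ω (n i)) (P i)) ∧
    Tendsto (fun i => Metric.hausdorffDist (P i) K) atTop (𝓝 0)

/-- A balanced maximum sofa with rotation angle `ω`: a monotone sofa whose cap is a balanced maximum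
cap. -/
def IsBalancedMaximumSofa (ω : ℝ) (S : Set Plane) : Prop :=
  IsMonotoneSofa ω S ∧ IsBalancedMaximumCap ω (capOf ω S)

/-- The closed triangle `Δ_ω` with vertices `O`, `o_ω - (0, 1)` and `o_ω - (cos ω, sin ω)`. -/
def triangle (ω : ℝ) : Set Plane :=
  convexHull ℝ {0, upperVertex ω - v 0, upperVertex ω - u ω}

end MovingSofa

end

/-! The sofa `S` itself works, without any rotation. Write `K` for its cap, `h` for the support
function of `K`, k = cos ω, s = sin ω and τ = tan(π/4 - ω/2), so that o_ω = (τ, 1).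

Suppose ω < π/2. Everything rests on the inclusion of Δ_ω in the niche of `K`. A monotone sofa
avoids the niche of its cap, hence avoids Δ_ω. For t in [ω, π/2], o_ω maximizes p ⋅ u_t over P_ω,
and every point of the fan outside Δ_ω falls short of that maximum by at most 1. So `S` lies in a
strip of width 1 normal to u_t, and after turning by ω it can go on turning up to π/2 inside the
vertical arm of its supporting hallway (`IsMonotoneSofa.isMovingSofa`). For ω = π/2 no further
turning is needed.

A single inner quadrant already covers Δ_ω once two support values are large
(`IsCap.triangle_subset_niche`). Area at least 2.2 forces w = max(h(0), h(ω + π/2)) to satisfy w(2 -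
kw) ≥ 2.2 (`IsCap.exists_large_support`), and reflection in the axis of P_ω allows w = h(0). The
quadrant of angle t = π/2 - ω is then used. Its first inequality follows from the size of w.

The second inequality comes from a variational balance (`IsMaximumPolygonCap.top_side_mem`). Slide
the strip ℝ × [0, 1] down by η while the walls of a maximum polygon cap stay fixed. To first order
the area gained per unit of η is the length of bottom side beyond the inner walls, and the area lost
is the length of the top side. Maximality therefore makes the top side reach a distance B to the
left of o_ω as soon as a length B of the bottom side lies beyond all inner walls. This passes to
Hausdorff limits, and some B > 2k is admissible, which is exactly what the second inequality needs.
-/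

open Set Filter Topology MeasureTheory

noncomputable section

namespace MovingSofa

/-- The scalar product `p ⋅ u_t`. -/
def proj (t : ℝ) (p : Plane) : ℝ := p 0 * Real.cos t + p 1 * Real.sin t

/-! ### Scalar products and support functions -/

lemma inner_u (p : Plane) (t : ℝ) : inner ℝ p (u t) = proj t p := by
  simp [PiLp.inner_apply, Fin.sum_univ_two, u, proj, mul_comm]

lemma proj_add_pi_div_two (t : ℝ) (p : Plane) :
    proj (t + Real.pi / 2) p = -(p 0 * Real.sin t) + p 1 * Real.cos t := by
  simp [proj, Real.cos_add_pi_div_two, Real.sin_add_pi_div_two]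

lemma proj_pi_div_two (p : Plane) : proj (Real.pi / 2) p = p 1 := by simp [proj]

lemma proj_zero_left (p : Plane) : proj 0 p = p 0 := by simp [proj]

lemma proj_add_pi (t : ℝ) (p : Plane) : proj (t + Real.pi) p = -proj t p := by
  simp [proj]; ring

lemma proj_three_pi_div_two (p : Plane) : proj (3 * Real.pi / 2) p = -p 1 := by
  rw [show 3 * Real.pi / 2 = Real.pi / 2 + Real.pi by ring, proj_add_pi, proj_pi_div_two]

lemma proj_add (t : ℝ) (p q : Plane) : proj t (p + q) = proj t p + proj t q := by
  simp [proj]; ring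

lemma proj_sub (t : ℝ) (p q : Plane) : proj t (p - q) = proj t p - proj t q := by
  simp [proj]; ring

lemma proj_smul (t c : ℝ) (p : Plane) : proj t (c • p) = c * proj t p := by
  simp [proj]; ring

lemma proj_origin (t : ℝ) : proj t 0 = 0 := by simp [proj]

lemma continuous_proj (t : ℝ) : Continuous (proj t) := by
  unfold proj; fun_prop

lemma abs_coord_le_norm (p : Plane) (i : Fin 2) : |p i| ≤ ‖p‖ := by
  simpa using PiLp.norm_apply_le p i

lemma abs_proj_le (t : ℝ) (p : Plane) : |proj t p| ≤ ‖p‖ := by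
  rw [← inner_u]
  refine (abs_real_inner_le_norm _ _).trans ?_
  have : ‖u t‖ = 1 := by simp [EuclideanSpace.norm_eq, u, Fin.sum_univ_two]
  rw [this, mul_one]

/-- `sin ω • u_t` is a combination of `u_0` and `u_ω`. -/
lemma sin_mul_proj (ω t : ℝ) (p : Plane) :
    Real.sin ω * proj t p = Real.sin (ω - t) * p 0 + Real.sin t * proj ω p := by
  simp only [proj, Real.sin_sub]; ring

lemma mem_halfPlane {t c : ℝ} {p : Plane} : p ∈ halfPlane t c ↔ proj t p ≤ c := by
  rw [halfPlane, mem_ofPred_eq, inner_u]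

lemma support_eq (S : Set Plane) (t : ℝ) : support S t = sSup (proj t '' S) := by
  simp only [support, inner_u]

lemma proj_le_support {S : Set Plane} (hS : IsCompact S) {p : Plane} (hp : p ∈ S) (t : ℝ) :
    proj t p ≤ support S t := by
  rw [support_eq]
  exact le_csSup (hS.image (continuous_proj t)).bddAbove (mem_image_of_mem _ hp)

lemma support_le {S : Set Plane} (hS : S.Nonempty) {t c : ℝ} (h : ∀ p ∈ S, proj t p ≤ c) :
    support S t ≤ c := by
  rw [support_eq]
  exact csSup_le (hS.image _) (by rintro _ ⟨p, hp, rfl⟩; exact h p hp)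

lemma exists_proj_eq_support {S : Set Plane} (hS : IsCompact S) (hne : S.Nonempty) (t : ℝ) :
    ∃ p ∈ S, proj t p = support S t := by
  rw [support_eq]
  exact (hS.image (continuous_proj t)).sSup_mem (hne.image _)

lemma support_eq_of_forall_le {S : Set Plane} {t c : ℝ} (h : ∀ p ∈ S, proj t p ≤ c)
    (h' : ∃ p ∈ S, proj t p = c) : support S t = c := by
  obtain ⟨p, hp, rfl⟩ := h'
  refine le_antisymm (support_le ⟨p, hp⟩ h) ?_
  rw [support_eq]
  exact le_csSup ⟨_, by rintro _ ⟨q, hq, rfl⟩; exact h q hq⟩ (mem_image_of_mem _ hp)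

/-- If `S` lies in the ball of radius M, then p ⋅ u_t is 2M-Lipschitz in t for each p in `S`, and
suprema inherit this. Continuity is needed for the translation part of the movement that follows the
supporting hallways. -/
lemma continuous_support {S : Set Plane} (hS : IsCompact S) (hne : S.Nonempty) :
    Continuous (support S) := by
  obtain ⟨M, hM⟩ := hS.isBounded.exists_norm_le
  have hM0 : 0 ≤ M := (norm_nonneg _).trans (hM _ hne.some_mem)
  have key : ∀ s t, support S s ≤ support S t + 2 * M * |s - t| := by
    intro s t
    refine support_le hne fun p hp => ?_
    have h1 := proj_le_support hS hp t
    have h0 := (abs_coord_le_norm p 0).trans (hM p hp)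
    have h1' := (abs_coord_le_norm p 1).trans (hM p hp)
    have hc : |Real.cos s - Real.cos t| ≤ |s - t| := by
      simpa [Real.dist_eq] using Real.lipschitzWith_cos.dist_le_mul s t
    have hs : |Real.sin s - Real.sin t| ≤ |s - t| := by
      simpa [Real.dist_eq] using Real.lipschitzWith_sin.dist_le_mul s t
    have e1 : p 0 * (Real.cos s - Real.cos t) ≤ M * |s - t| := by
      refine (le_abs_self _).trans ?_
      rw [abs_mul]; gcongr
    have e2 : p 1 * (Real.sin s - Real.sin t) ≤ M * |s - t| := by
      refine (le_abs_self _).trans ?_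
      rw [abs_mul]; gcongr
    simp only [proj] at h1 ⊢
    linarith
  have : LipschitzWith (Real.toNNReal (2 * M)) (support S) := by
    refine LipschitzWith.of_dist_le_mul fun s t => ?_
    rw [Real.dist_eq, Real.dist_eq, Real.coe_toNNReal _ (by positivity), abs_le]
    have h1 := key s t
    have h2 := key t s
    rw [abs_sub_comm t s] at h2
    constructor <;> linarith
  exact this.continuous

/-- Inverting the rigid motion turns membership in hallways and quadrants into inequalities between
projections and support values; all later arguments use only those. -/
lemma mem_hallwayMap_image {S A : Set Plane} {t : ℝ} {p : Plane} :
    p ∈ hallwayMap S t '' A ↔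
      !₂[proj t p - support S t + 1,
        proj (t + Real.pi / 2) p - support S (t + Real.pi / 2) + 1] ∈ A := by
  have hcs := Real.sin_sq_add_cos_sq t
  constructor
  · rintro ⟨q, hq, rfl⟩
    convert hq using 1
    ext i
    rw [proj_add_pi_div_two]
    fin_cases i <;> simp [hallwayMap, proj, rot, u, v]
    · linear_combination (q 0 + support S t - 1) * hcs
    · linear_combination (q 1 + support S (t + Real.pi / 2) - 1) * hcs
  · intro h
    refine ⟨_, h, ?_⟩
    rw [proj_add_pi_div_two]
    ext i
    fin_cases i <;> simp [hallwayMap, proj, rot, u, v]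
    · linear_combination (p 0) * hcs
    · linear_combination (p 1) * hcs

lemma mem_outerQuadrant {S : Set Plane} {t : ℝ} {p : Plane} :
    p ∈ outerQuadrant S t ↔
      proj t p ≤ support S t ∧ proj (t + Real.pi / 2) p ≤ support S (t + Real.pi / 2) := by
  rw [outerQuadrant, mem_hallwayMap_image]
  simp

lemma mem_innerQuadrant {S : Set Plane} {t : ℝ} {p : Plane} :
    p ∈ innerQuadrant S t ↔
      proj t p < support S t - 1 ∧
        proj (t + Real.pi / 2) p < support S (t + Real.pi / 2) - 1 := by
  rw [innerQuadrant, mem_hallwayMap_image]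
  simp only [mem_ofPred_eq]
  constructor <;> rintro ⟨h1, h2⟩ <;> constructor <;> simp at * <;> linarith

lemma mem_hallway {p : Plane} : p ∈ hallway ↔ p 0 ≤ 1 ∧ p 1 ≤ 1 ∧ (0 ≤ p 0 ∨ 0 ≤ p 1) := by
  simp only [hallway, horizontalSide, verticalSide, mem_union, mem_ofPred_eq]
  tauto

lemma mem_supportingHallway {S : Set Plane} {t : ℝ} {p : Plane} :
    p ∈ supportingHallway S t ↔
      proj t p ≤ support S t ∧ proj (t + Real.pi / 2) p ≤ support S (t + Real.pi / 2) ∧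
        (support S t - 1 ≤ proj t p ∨
          support S (t + Real.pi / 2) - 1 ≤ proj (t + Real.pi / 2) p) := by
  rw [supportingHallway, mem_hallwayMap_image, mem_hallway]
  simp only [Matrix.cons_val_zero, Matrix.cons_val_one]
  refine and_congr (by constructor <;> intro <;> linarith)
    (and_congr (by constructor <;> intro <;> linarith) (or_congr ?_ ?_)) <;>
    constructor <;> intro <;> linarith

lemma rot_coord_neg (t : ℝ) (p : Plane) :
    rot (-t) p = !₂[proj t p, proj (t + Real.pi / 2) p] := by
  rw [proj_add_pi_div_two]
  ext i
  fin_cases i <;> simp [rot, proj] <;> ring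

lemma mem_parallelogram {ω : ℝ} {p : Plane} :
    p ∈ parallelogram ω ↔ (0 ≤ p 1 ∧ p 1 ≤ 1) ∧ 0 ≤ proj ω p ∧ proj ω p ≤ 1 := by
  have hcs := Real.sin_sq_add_cos_sq ω
  refine and_congr Iff.rfl ?_
  constructor
  · rintro ⟨q, hq, rfl⟩
    have : proj ω (rot ω q) = q 0 := by
      simp [proj, rot]; linear_combination (q 0) * hcs
    rw [this]; exact hq
  · intro h
    refine ⟨rot (-ω) p, ?_, ?_⟩
    · rw [rot_coord_neg]; simpa [vStrip] using h
    · ext i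
      fin_cases i <;> simp [rot]
      · linear_combination (p 0) * hcs
      · linear_combination (p 1) * hcs

lemma mem_fan {ω : ℝ} {p : Plane} : p ∈ fan ω ↔ 0 ≤ proj ω p ∧ 0 ≤ p 1 := by
  rw [fan, mem_ofPred_eq, inner_u, inner_u, proj_pi_div_two]

lemma mem_monotonization {ω : ℝ} {S : Set Plane} {p : Plane} :
    p ∈ monotonization ω S ↔ p ∈ parallelogram ω ∧ ∀ t ∈ Icc 0 ω, p ∈ supportingHallway S t := by
  simp only [monotonization, mem_inter_iff, mem_iInter₂]

lemma mem_capOf {ω : ℝ} {S : Set Plane} {p : Plane} :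
    p ∈ capOf ω S ↔ p ∈ parallelogram ω ∧ ∀ t ∈ Icc 0 ω, p ∈ outerQuadrant S t := by
  simp only [capOf, mem_inter_iff, mem_iInter₂]

lemma mem_niche {ω : ℝ} {K : Set Plane} {p : Plane} :
    p ∈ niche ω K ↔ p ∈ fan ω ∧ ∃ t ∈ Ioo 0 ω, p ∈ innerQuadrant K t := by
  simp only [niche, mem_inter_iff, mem_iUnion₂, exists_prop]

lemma mem_polygonCap {ω : ℝ} {Θ : Finset ℝ} {K : Set Plane} {p : Plane} :
    p ∈ polygonCap ω Θ K ↔ p ∈ parallelogram ω ∧ ∀ t ∈ Θ, p ∈ outerQuadrant K t := by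
  simp only [polygonCap, mem_inter_iff, mem_iInter₂]

lemma mem_polygonNiche {ω : ℝ} {Θ : Finset ℝ} {K : Set Plane} {p : Plane} :
    p ∈ polygonNiche ω Θ K ↔ p ∈ fan ω ∧ ∃ t ∈ Θ, p ∈ innerQuadrant K t := by
  simp only [polygonNiche, mem_inter_iff, mem_iUnion₂, exists_prop]

lemma isClosed_parallelogram (ω : ℝ) : IsClosed (parallelogram ω) := by
  have : parallelogram ω =
      {p : Plane | 0 ≤ p 1} ∩ {p | p 1 ≤ 1} ∩ {p | 0 ≤ proj ω p} ∩ {p | proj ω p ≤ 1} := by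
    ext p; rw [mem_parallelogram]; simp only [mem_inter_iff, mem_ofPred_eq]; tauto
  rw [this]
  have c1 : Continuous fun p : Plane => p 1 := by fun_prop
  have c2 := continuous_proj ω
  exact (((isClosed_le continuous_const c1).inter (isClosed_le c1 continuous_const)).inter
    (isClosed_le continuous_const c2)).inter (isClosed_le c2 continuous_const)

lemma isBounded_of_coord {S : Set Plane} {M : ℝ} (h : ∀ p ∈ S, |p 0| ≤ M ∧ |p 1| ≤ M) :
    Bornology.IsBounded S := by
  refine (Metric.isBounded_closedBall (x := (0 : Plane)) (r := M + M)).subset fun p hp => ?_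
  rw [mem_closedBall_zero_iff, EuclideanSpace.norm_eq, Fin.sum_univ_two]
  obtain ⟨h0, h1⟩ := h p hp
  have a0 := abs_nonneg (p 0)
  have a1 := abs_nonneg (p 1)
  refine Real.sqrt_le_iff.2 ⟨by linarith, ?_⟩
  simp only [Real.norm_eq_abs]
  nlinarith

/-! ### Movements through supporting hallways -/

lemma proj_add_smul_sub (t c : ℝ) (p q : Plane) :
    proj t (p + c • (q - p)) = proj t p + c * (proj t q - proj t p) := by
  rw [proj_add, proj_smul, proj_sub]

/-- A compact connected set that fits in all its supporting hallways with angles in `[0, α]` can be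
moved by following them. -/
lemma isMovingSofa_of_subset_supportingHallway {S : Set Plane} {α : ℝ} (hα : 0 ≤ α)
    (hS : IsCompact S) (hc : IsConnected S)
    (hL : ∀ t ∈ Icc 0 α, S ⊆ supportingHallway S t)
    (h0 : ∀ p ∈ S, support S (Real.pi / 2) - 1 ≤ p 1)
    (h1 : ∀ p ∈ S, support S α - 1 ≤ proj α p) : IsMovingSofa S α := by
  have hcont := continuous_support hS hc.nonempty
  refine ⟨hc, hS.isClosed, fun s => -(α * s),
    fun s => !₂[1 - support S (α * s), 1 - support S (α * s + Real.pi / 2)],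
    by fun_prop, ?_, by simp, by simp, ?_, ?_, ?_⟩
  · refine (PiLp.continuous_toLp 2 _).comp (continuous_pi fun i => ?_)
    fin_cases i
    · exact continuous_const.sub (hcont.comp (by fun_prop))
    · exact continuous_const.sub (hcont.comp (by fun_prop))
  · rintro _ ⟨p, hp, rfl⟩
    have e1 := proj_le_support hS hp 0
    have e2 := proj_le_support hS hp (Real.pi / 2)
    have e3 := h0 p hp
    rw [proj_zero_left] at e1
    rw [proj_pi_div_two] at e2
    simp only [rot_coord_neg, horizontalSide, mem_ofPred_eq]
    simp [proj_zero_left, proj_pi_div_two]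
    exact ⟨by linarith, by linarith, by linarith⟩
  · rintro s _ ⟨p, hp, rfl⟩
    have hs : α * s ∈ Icc 0 α :=
      ⟨mul_nonneg hα s.2.1, mul_le_of_le_one_right hα s.2.2⟩
    obtain ⟨e1, e2, e3⟩ := mem_supportingHallway.1 (hL _ hs hp)
    simp only [rot_coord_neg, mem_hallway]
    simp
    refine ⟨by linarith, by linarith, ?_⟩
    rcases e3 with e3 | e3
    · left; linarith
    · right; linarith
  · rintro _ ⟨p, hp, rfl⟩
    have e1 := proj_le_support hS hp α
    have e2 := proj_le_support hS hp (α + Real.pi / 2)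
    have e3 := h1 p hp
    simp only [rot_coord_neg, verticalSide, mem_ofPred_eq]
    simp
    exact ⟨by linarith, by linarith, by linarith⟩

/-! ### Moving sofas in standard position -/

section MovingSofaFacts

variable {ω : ℝ} {S' : Set Plane}

/-- The initial placement bounds the height on both sides and the abscissa from above. The end wall
of the final placement bounds p ⋅ u_{ω+π/2} from above, which bounds the abscissa from below because
sin ω > 0. -/
lemma IsMovingSofa.isCompact (hω : ω ∈ Ioc 0 (Real.pi / 2)) (h : IsMovingSofa S' ω) :
    IsCompact S' := by
  obtain ⟨-, hcl, θ, c, -, -, hθ0, hθ1, hH, -, hV⟩ := h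
  refine Metric.isCompact_of_isClosed_isBounded hcl ?_
  have hs : 0 < Real.sin ω := Real.sin_pos_of_pos_of_lt_pi hω.1 (by linarith [hω.2, Real.pi_pos])
  have hc : 0 ≤ Real.cos ω :=
    Real.cos_nonneg_of_neg_pi_div_two_le_of_le (by linarith [hω.1, Real.pi_pos]) hω.2
  set A := 1 - c 0 0
  set D := |c 0 1| + 1
  set B := 1 - c 1 1
  set C := (-B - D) / Real.sin ω
  refine isBounded_of_coord (M := max D (|A| + |C|)) fun p hp => ?_
  have e1 := hH ⟨p, hp, rfl⟩
  have e2 := hV ⟨p, hp, rfl⟩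
  rw [hθ0, ← neg_zero] at e1
  rw [hθ1] at e2
  simp only [rot_coord_neg, horizontalSide, verticalSide, mem_ofPred_eq] at e1 e2
  simp [proj_zero_left, proj_pi_div_two, proj_add_pi_div_two] at e1 e2
  have y1 : |p 1| ≤ D := by
    have := abs_le.1 (le_refl |c 0 1|)
    rw [abs_le]; constructor <;> simp only [D] <;> linarith
  refine ⟨?_, y1.trans (le_max_left _ _)⟩
  refine le_trans ?_ (le_max_right _ _)
  have x1 : p 0 ≤ A := by simp only [A]; linarith
  have x2 : C ≤ p 0 := by
    rw [div_le_iff₀ hs]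
    have : -D ≤ p 1 * Real.cos ω := by
      have hle := abs_le.1 y1
      have : 0 ≤ D := (abs_nonneg _).trans y1
      nlinarith [Real.cos_le_one ω]
    have : p 0 * Real.sin ω ≥ -B + p 1 * Real.cos ω := by simp only [B]; linarith
    linarith
  rw [abs_le]
  constructor <;> linarith [neg_abs_le C, le_abs_self A, abs_nonneg A, abs_nonneg C]

/-- The two end placements confine the sofa to strips of width 1 with normals u_{π/2} and u_ω;
standard position fixes the upper edges of these strips. -/
lemma IsMovingSofa.subset_parallelogram (hω : ω ∈ Ioc 0 (Real.pi / 2)) (h : IsMovingSofa S' ω)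
    (hst : IsStandardPosition ω S') : S' ⊆ parallelogram ω := by
  have hcpt := h.isCompact hω
  obtain ⟨hcn, hcl, θ, c, -, -, hθ0, hθ1, hH, -, hV⟩ := h
  have hH' : ∀ p ∈ S', 0 ≤ p 1 + c 0 1 ∧ p 1 + c 0 1 ≤ 1 := by
    intro p hp
    have e1 := hH ⟨p, hp, rfl⟩
    rw [hθ0, ← neg_zero] at e1
    simp only [rot_coord_neg, horizontalSide, mem_ofPred_eq] at e1
    simpa [proj_zero_left, proj_pi_div_two] using e1.2
  have hV' : ∀ p ∈ S', 0 ≤ proj ω p + c 1 0 ∧ proj ω p + c 1 0 ≤ 1 := by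
    intro p hp
    have e1 := hV ⟨p, hp, rfl⟩
    rw [hθ1] at e1
    simp only [rot_coord_neg, verticalSide, mem_ofPred_eq] at e1
    simp at e1
    exact ⟨e1.1, e1.2.1⟩
  obtain ⟨a, ha, ha'⟩ := exists_proj_eq_support hcpt hcn.nonempty (Real.pi / 2)
  obtain ⟨b, hb, hb'⟩ := exists_proj_eq_support hcpt hcn.nonempty ω
  rw [hst.2, proj_pi_div_two] at ha'
  rw [hst.1] at hb'
  intro p hp
  have p1 := proj_le_support hcpt hp (Real.pi / 2)
  have p2 := proj_le_support hcpt hp ω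
  rw [hst.2, proj_pi_div_two] at p1
  rw [hst.1] at p2
  rw [mem_parallelogram]
  have := hH' p hp
  have := hH' a ha
  have := hV' p hp
  have := hV' b hb
  exact ⟨⟨by linarith, p1⟩, by linarith, p2⟩

/-- By the intermediate value theorem the movement passes through the angle t. Pushing the hallway
of that moment inwards until its outer walls touch the sofa only moves the inner corner away from
it. -/
lemma IsMovingSofa.subset_supportingHallway (hω : ω ∈ Ioc 0 (Real.pi / 2))
    (h : IsMovingSofa S' ω) {t : ℝ} (ht : t ∈ Icc 0 ω) : S' ⊆ supportingHallway S' t := by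
  have hcpt := h.isCompact hω
  obtain ⟨hcn, hcl, θ, c, hθ, -, hθ0, hθ1, -, hL, -⟩ := h
  obtain ⟨s, hs⟩ : -t ∈ range θ := by
    refine mem_range_of_exists_le_of_exists_ge hθ ⟨1, ?_⟩ ⟨0, ?_⟩
    · rw [hθ1]; linarith [ht.2]
    · rw [hθ0]; linarith [ht.1]
  have hL' : ∀ p ∈ S', proj t p + c s 0 ≤ 1 ∧ proj (t + Real.pi / 2) p + c s 1 ≤ 1 ∧
      (0 ≤ proj t p + c s 0 ∨ 0 ≤ proj (t + Real.pi / 2) p + c s 1) := by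
    intro p hp
    have e1 := hL s ⟨p, hp, rfl⟩
    rw [hs] at e1
    simp only [rot_coord_neg, mem_hallway] at e1
    simpa using e1
  obtain ⟨a, ha, ha'⟩ := exists_proj_eq_support hcpt hcn.nonempty t
  obtain ⟨b, hb, hb'⟩ := exists_proj_eq_support hcpt hcn.nonempty (t + Real.pi / 2)
  intro p hp
  rw [mem_supportingHallway]
  refine ⟨proj_le_support hcpt hp _, proj_le_support hcpt hp _, ?_⟩
  have e1 := (hL' a ha).1
  have e2 := (hL' b hb).2.1
  rcases (hL' p hp).2.2 with e | e
  · left; linarith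
  · right; linarith

end MovingSofaFacts

/-- The directions with angles in [ω, π/2] are those common to all quadrants spanned by u_t and v_t
with t in [0, ω]. The condition `0 ≤ d 1` follows from the other two unless ω = π/2. -/
lemma proj_nonneg_of_cone {ω t : ℝ} (hω : ω ∈ Ioc 0 (Real.pi / 2)) (ht : t ∈ Icc 0 ω) {d : Plane}
    (h0 : 0 ≤ d 0) (h1 : 0 ≤ proj (ω + Real.pi / 2) d) (h2 : 0 ≤ d 1) :
    0 ≤ proj t d ∧ 0 ≤ proj (t + Real.pi / 2) d := by
  have hpi := Real.pi_pos
  have c0 : 0 ≤ Real.cos t :=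
    Real.cos_nonneg_of_neg_pi_div_two_le_of_le (by linarith [ht.1]) (by linarith [ht.2, hω.2])
  have s0 : 0 ≤ Real.sin t :=
    Real.sin_nonneg_of_nonneg_of_le_pi ht.1 (by linarith [ht.2, hω.2])
  have sω : 0 < Real.sin ω := Real.sin_pos_of_pos_of_lt_pi hω.1 (by linarith [hω.2])
  have s1 : 0 ≤ Real.sin (ω - t) :=
    Real.sin_nonneg_of_nonneg_of_le_pi (by linarith [ht.2]) (by linarith [ht.1, hω.2])
  refine ⟨by unfold proj; positivity, ?_⟩
  have key : Real.sin ω * proj (t + Real.pi / 2) d =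
      Real.sin (ω - t) * d 1 + Real.sin t * proj (ω + Real.pi / 2) d := by
    simp only [proj_add_pi_div_two, Real.sin_sub]; ring
  by_contra hneg
  push Not at hneg
  have : 0 ≤ Real.sin ω * proj (t + Real.pi / 2) d := by rw [key]; positivity
  nlinarith

/-- Segments whose direction lies in the cone spanned by `u_ω` and `u_{π/2}` stay in the
monotonization. -/
lemma segment_subset_monotonization {ω : ℝ} {S' : Set Plane} {p q : Plane}
    (hp : p ∈ monotonization ω S') (hq : q ∈ monotonization ω S')
    (hd : ∀ t ∈ Icc 0 ω, 0 ≤ proj t (q - p) ∧ 0 ≤ proj (t + Real.pi / 2) (q - p)) :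
    segment ℝ p q ⊆ monotonization ω S' := by
  rw [segment_eq_image']
  rintro _ ⟨c, ⟨hc0, hc1⟩, rfl⟩
  rw [mem_monotonization, mem_parallelogram] at *
  have conv : ∀ {a b B : ℝ}, a ≤ B → b ≤ B → a + c * (b - a) ≤ B := by
    intro a b B ha hb; nlinarith
  have conv' : ∀ {a b B : ℝ}, B ≤ a → B ≤ b → B ≤ a + c * (b - a) := by
    intro a b B ha hb; nlinarith
  have e1 : (p + c • (q - p)) 1 = p 1 + c * (q 1 - p 1) := by simp
  simp only [e1, proj_add_smul_sub]
  refine ⟨⟨⟨conv' hp.1.1.1 hq.1.1.1, conv hp.1.1.2 hq.1.1.2⟩, conv' hp.1.2.1 hq.1.2.1,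
    conv hp.1.2.2 hq.1.2.2⟩, fun t ht => ?_⟩
  have hpt := mem_supportingHallway.1 (hp.2 t ht)
  have hqt := mem_supportingHallway.1 (hq.2 t ht)
  have hdt := hd t ht
  rw [proj_sub, proj_sub] at hdt
  rw [mem_supportingHallway, proj_add_smul_sub, proj_add_smul_sub]
  refine ⟨conv hpt.1 hqt.1, conv hpt.2.1 hqt.2.1, ?_⟩
  rcases hpt.2.2 with h | h
  · left; linarith [mul_nonneg hc0 hdt.1]
  · right; linarith [mul_nonneg hc0 hdt.2]

lemma subset_monotonization {ω : ℝ} {S' : Set Plane} (hω : ω ∈ Ioc 0 (Real.pi / 2))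
    (h : IsMovingSofa S' ω) (hst : IsStandardPosition ω S') : S' ⊆ monotonization ω S' :=
  fun _ hp => mem_monotonization.2
    ⟨h.subset_parallelogram hω hst hp, fun _ ht => h.subset_supportingHallway hω ht hp⟩

lemma isClosed_supportingHallway (S : Set Plane) (t : ℝ) : IsClosed (supportingHallway S t) := by
  have : supportingHallway S t = {p | proj t p ≤ support S t} ∩
      ({p | proj (t + Real.pi / 2) p ≤ support S (t + Real.pi / 2)} ∩
        ({p | support S t - 1 ≤ proj t p} ∪
          {p | support S (t + Real.pi / 2) - 1 ≤ proj (t + Real.pi / 2) p})) := by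
    ext p; rw [mem_supportingHallway]; rfl
  rw [this]
  have c1 := continuous_proj t
  have c2 := continuous_proj (t + Real.pi / 2)
  exact (isClosed_le c1 continuous_const).inter ((isClosed_le c2 continuous_const).inter
    ((isClosed_le continuous_const c1).union (isClosed_le continuous_const c2)))

lemma isCompact_monotonization {ω : ℝ} {S' : Set Plane} (hω : ω ∈ Ioc 0 (Real.pi / 2)) :
    IsCompact (monotonization ω S') := by
  have hs : 0 < Real.sin ω := Real.sin_pos_of_pos_of_lt_pi hω.1 (by linarith [hω.2, Real.pi_pos])
  have hc : 0 ≤ Real.cos ω :=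
    Real.cos_nonneg_of_neg_pi_div_two_le_of_le (by linarith [hω.1, Real.pi_pos]) hω.2
  refine Metric.isCompact_of_isClosed_isBounded ?_ ?_
  · exact (isClosed_parallelogram ω).inter
      (isClosed_biInter fun t _ => isClosed_supportingHallway S' t)
  · set A := support S' 0
    set B := support S' (ω + Real.pi / 2)
    refine isBounded_of_coord (M := max 1 (|A| + |-B / Real.sin ω|)) fun p hp => ?_
    rw [mem_monotonization, mem_parallelogram] at hp
    have e0 := (mem_supportingHallway.1 (hp.2 0 ⟨le_rfl, hω.1.le⟩)).1
    have e1 := (mem_supportingHallway.1 (hp.2 ω ⟨hω.1.le, le_rfl⟩)).2.1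
    rw [proj_zero_left] at e0
    rw [proj_add_pi_div_two] at e1
    refine ⟨le_max_of_le_right ?_, le_max_of_le_left ?_⟩
    · have x2 : -B / Real.sin ω ≤ p 0 := by
        rw [div_le_iff₀ hs]
        nlinarith [mul_nonneg hp.1.1.1 hc]
      rw [abs_le]
      constructor <;>
        linarith [neg_abs_le (-B / Real.sin ω), le_abs_self A, abs_nonneg A,
          abs_nonneg (-B / Real.sin ω)]
    · rw [abs_le]; constructor <;> linarith [hp.1.1.1, hp.1.1.2]

/-- The outer walls of the hallways give one inequality and the inclusion of `S'` gives the other.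
Hence the monotonization has the same supporting hallways as `S'` for angles in [0, ω]. -/
lemma support_monotonization {ω t : ℝ} {S' : Set Plane} (hω : ω ∈ Ioc 0 (Real.pi / 2))
    (h : IsMovingSofa S' ω) (hst : IsStandardPosition ω S') (ht : t ∈ Icc 0 ω) :
    support (monotonization ω S') t = support S' t ∧
      support (monotonization ω S') (t + Real.pi / 2) = support S' (t + Real.pi / 2) := by
  have hcpt := h.isCompact hω
  have hsub := subset_monotonization hω h hst
  obtain ⟨a, ha, ha'⟩ := exists_proj_eq_support hcpt h.1.nonempty t
  obtain ⟨b, hb, hb'⟩ := exists_proj_eq_support hcpt h.1.nonempty (t + Real.pi / 2)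
  exact ⟨support_eq_of_forall_le
      (fun p hp => (mem_supportingHallway.1 ((mem_monotonization.1 hp).2 t ht)).1)
      ⟨a, hsub ha, ha'⟩,
    support_eq_of_forall_le
      (fun p hp => (mem_supportingHallway.1 ((mem_monotonization.1 hp).2 t ht)).2.1)
      ⟨b, hsub hb, hb'⟩⟩

/-- Every point is joined to the connected set `S'` by a segment whose direction lies, up to sign,
in the cone between u_ω and u_{π/2}; such segments never cross an inner quadrant. -/
lemma isConnected_monotonization {ω : ℝ} {S' : Set Plane} (hω : ω ∈ Ioc 0 (Real.pi / 2))
    (h : IsMovingSofa S' ω) (hst : IsStandardPosition ω S') :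
    IsConnected (monotonization ω S') := by
  have hcpt := h.isCompact hω
  have hsub := subset_monotonization hω h hst
  have hpi := Real.pi_pos
  have hs : 0 < Real.sin ω := Real.sin_pos_of_pos_of_lt_pi hω.1 (by linarith [hω.2])
  have hc : 0 ≤ Real.cos ω :=
    Real.cos_nonneg_of_neg_pi_div_two_le_of_le (by linarith [hω.1]) hω.2
  have hcs := Real.sin_sq_add_cos_sq ω
  obtain ⟨x₀, hx₀⟩ := h.1.nonempty
  have key : ∀ p ∈ monotonization ω S', ∃ q ∈ S', segment ℝ p q ⊆ monotonization ω S' := by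
    intro p hp
    have join : ∀ q ∈ S', (∀ t ∈ Icc 0 ω, 0 ≤ proj t (q - p) ∧ 0 ≤ proj (t + Real.pi / 2) (q - p))
        ∨ (∀ t ∈ Icc 0 ω, 0 ≤ proj t (p - q) ∧ 0 ≤ proj (t + Real.pi / 2) (p - q)) →
        segment ℝ p q ⊆ monotonization ω S' := by
      rintro q hq (hd | hd)
      · exact segment_subset_monotonization hp (hsub hq) hd
      · rw [segment_symm]; exact segment_subset_monotonization (hsub hq) hp hd
    -- As `S'` is connected, it meets each line through `p` or lies strictly on one side. This is
    -- applied to the lines in the directions u_{π/2} and u_ω; the sides with smaller projections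
    -- are excluded because `S'` attains its support values at 0 and ω + π/2.
    have conn : ∀ t : ℝ, (∃ q ∈ S', proj t q = proj t p) ∨ (∀ q ∈ S', proj t p < proj t q) ∨
        (∀ q ∈ S', proj t q < proj t p) := by
      intro t
      by_contra! hcon
      obtain ⟨h1, ⟨a, ha, ha'⟩, b, hb, hb'⟩ := hcon
      obtain ⟨q, hq, hq'⟩ := h.1.isPreconnected.intermediate_value ha hb
        (continuous_proj t).continuousOn ⟨ha', hb'⟩
      exact h1 q hq hq'
    have hp' := mem_monotonization.1 hp
    rcases conn 0 with ⟨q, hq, hqp⟩ | h0 | h0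
    · refine ⟨q, hq, join q hq ?_⟩
      simp only [proj_zero_left] at hqp
      rcases le_total (p 1) (q 1) with hle | hle
      · left
        intro t ht
        refine proj_nonneg_of_cone hω ht ?_ ?_ ?_ <;> simp [proj_add_pi_div_two, hqp] <;> nlinarith
      · right
        intro t ht
        refine proj_nonneg_of_cone hω ht ?_ ?_ ?_ <;> simp [proj_add_pi_div_two, hqp] <;> nlinarith
    · rcases conn (ω + Real.pi / 2) with ⟨q, hq, hqp⟩ | h1 | h1
      · refine ⟨q, hq, join q hq (Or.inl fun t ht => ?_)⟩
        have h0q := h0 q hq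
        simp only [proj_zero_left] at h0q
        refine proj_nonneg_of_cone hω ht ?_ ?_ ?_
        · simpa using h0q.le
        · rw [proj_sub, hqp, sub_self]
        · simp only [proj_add_pi_div_two] at hqp
          simp only [PiLp.sub_apply]
          by_contra! hneg
          nlinarith
      · refine ⟨x₀, hx₀, join x₀ hx₀ (Or.inl fun t ht => ?_)⟩
        have h0q := h0 x₀ hx₀
        have h1q := h1 x₀ hx₀
        simp only [proj_zero_left] at h0q
        refine proj_nonneg_of_cone hω ht ?_ ?_ ?_
        · simpa using h0q.le
        · rw [proj_sub]; linarith
        · simp only [proj_add_pi_div_two] at h1q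
          simp only [PiLp.sub_apply]
          by_contra! hneg
          nlinarith
      · obtain ⟨q, hq, hq'⟩ := exists_proj_eq_support hcpt h.1.nonempty (ω + Real.pi / 2)
        have := h1 q hq
        have := (mem_supportingHallway.1 (hp'.2 ω ⟨hω.1.le, le_rfl⟩)).2.1
        linarith
    · obtain ⟨q, hq, hq'⟩ := exists_proj_eq_support hcpt h.1.nonempty 0
      have := h0 q hq
      have := (mem_supportingHallway.1 (hp'.2 0 ⟨le_rfl, hω.1.le⟩)).1
      linarith
  refine ⟨⟨x₀, hsub hx₀⟩, isPreconnected_of_forall x₀ fun p hp => ?_⟩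
  obtain ⟨q, hq, hseg⟩ := key p hp
  exact ⟨segment ℝ p q ∪ S', union_subset hseg hsub, Or.inr hx₀, Or.inl (left_mem_segment ℝ p q),
    IsPreconnected.union q (right_mem_segment ℝ p q) hq (convex_segment p q).isPreconnected
      h.1.isPreconnected⟩

/-! ### The triangle below the vertex -/

section Triangle

variable {ω : ℝ}

lemma tan_mul_cos (hω : ω ∈ Ioo 0 (Real.pi / 2)) :
    Real.tan (Real.pi / 4 - ω / 2) * Real.cos ω = 1 - Real.sin ω := by
  have hpi := Real.pi_pos
  set δ := Real.pi / 4 - ω / 2 with hδ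
  have hω' : ω = Real.pi / 2 - 2 * δ := by rw [hδ]; ring
  have hc : Real.cos δ ≠ 0 :=
    (Real.cos_pos_of_mem_Ioo ⟨by linarith [hω.2], by linarith [hω.1]⟩).ne'
  rw [hω', Real.cos_pi_div_two_sub, Real.sin_pi_div_two_sub, Real.sin_two_mul, Real.cos_two_mul,
    Real.tan_eq_sin_div_cos]
  field_simp
  linear_combination 2 * Real.sin_sq_add_cos_sq δ

lemma proj_upperVertex (t : ℝ) :
    proj t (upperVertex ω) = Real.tan (Real.pi / 4 - ω / 2) * Real.cos t + Real.sin t := by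
  simp [proj, upperVertex]

lemma tan_pos (hω : ω ∈ Ioo 0 (Real.pi / 2)) : 0 < Real.tan (Real.pi / 4 - ω / 2) :=
  Real.tan_pos_of_pos_of_lt_pi_div_two (by linarith [hω.2]) (by linarith [hω.1, Real.pi_pos])

/-- Together with `upperVertex_sub_u`: the nonzero vertices of Δ_ω lie on the two edges of the fan,
both at distance τ from the origin. -/
lemma upperVertex_sub_v :
    upperVertex ω - v 0 = !₂[Real.tan (Real.pi / 4 - ω / 2), 0] := by
  ext i; fin_cases i <;> simp [upperVertex, v]

lemma upperVertex_sub_u (hω : ω ∈ Ioo 0 (Real.pi / 2)) :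
    upperVertex ω - u ω = Real.tan (Real.pi / 4 - ω / 2) • v ω := by
  have h := tan_mul_cos hω
  have hc : Real.cos ω ≠ 0 :=
    (Real.cos_pos_of_mem_Ioo ⟨by linarith [hω.1, Real.pi_pos], hω.2⟩).ne'
  ext i; fin_cases i <;> simp [upperVertex, v, u]
  · apply mul_right_cancel₀ hc
    linear_combination (1 + Real.sin ω) * h - Real.sin_sq_add_cos_sq ω
  · linear_combination -h

lemma proj_v (t s : ℝ) : proj t (v s) = Real.sin (t - s) := by
  simp [proj, v, Real.sin_sub]; ring

/-- A point of the fan outside of the triangle is at distance at most one below the supporting lines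
through the vertex with normal angles between `ω` and `π/2`. -/
lemma sub_one_le_proj_of_notMem_triangle (hω : ω ∈ Ioo 0 (Real.pi / 2)) {p : Plane}
    (hp : p ∈ fan ω) (hpt : p ∉ triangle ω) {t : ℝ} (ht : t ∈ Icc ω (Real.pi / 2)) :
    proj t (upperVertex ω) - 1 ≤ proj t p := by
  have hpi := Real.pi_pos
  set τ := Real.tan (Real.pi / 4 - ω / 2) with hτ
  have hτ0 : 0 < τ := tan_pos hω
  have hkc : 0 < Real.cos ω := Real.cos_pos_of_mem_Ioo ⟨by linarith [hω.1], hω.2⟩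
  have hcs := Real.sin_sq_add_cos_sq ω
  rw [mem_fan] at hp
  -- These are the oblique coordinates along the edges (1, 0) and v_ω of the fan. In them Δ_ω is
  -- given by a, b ≥ 0 and a + b ≤ τ.
  set a := proj ω p / Real.cos ω with ha
  set b := p 1 / Real.cos ω with hb
  have ha0 : 0 ≤ a := div_nonneg hp.1 hkc.le
  have hb0 : 0 ≤ b := div_nonneg hp.2 hkc.le
  have hpe : p = a • (!₂[1, 0] : Plane) + b • v ω := by
    ext i; fin_cases i
    · simp [v, ha, hb, proj]; field_simp; ring
    · simp [v, hb]; field_simp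
  have hsum : τ < a + b := by
    by_contra! hle
    apply hpt
    rw [triangle, upperVertex_sub_v, upperVertex_sub_u hω, ← hτ,
      convexHull_insert (by simp), convexHull_pair]
    rw [mem_convexJoin]
    refine ⟨0, rfl, ?_⟩
    rcases eq_or_lt_of_le (add_nonneg ha0 hb0) with h0 | h0
    · refine ⟨_, left_mem_segment _ _ _, ?_⟩
      have ha1 : a = 0 := by linarith
      have hb1 : b = 0 := by linarith
      rw [hpe, ha1, hb1]; simpa using left_mem_segment ℝ _ _
    · refine ⟨(τ / (a + b)) • p, ⟨a / (a + b), b / (a + b), by positivity, by positivity,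
        by field_simp, ?_⟩, ⟨1 - (a + b) / τ, (a + b) / τ, ?_, by positivity, by ring, ?_⟩⟩
      · rw [hpe]
        ext i; fin_cases i <;> simp <;> field_simp
      · rw [sub_nonneg, div_le_one hτ0]; exact hle
      · rw [smul_zero, zero_add, smul_smul]
        rw [show (a + b) / τ * (τ / (a + b)) = 1 by field_simp, one_smul]
  have hpr : proj t p = a * Real.cos t + b * Real.sin (t - ω) := by
    rw [hpe, proj_add, proj_smul, proj_smul, proj_v]
    simp [proj]
  have c0 : 0 ≤ Real.cos t :=
    Real.cos_nonneg_of_neg_pi_div_two_le_of_le (by linarith [ht.1, hω.1]) ht.2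
  have s0 : 0 ≤ Real.sin (t - ω) :=
    Real.sin_nonneg_of_nonneg_of_le_pi (by linarith [ht.1]) (by linarith [ht.2, hω.1])
  rw [hpr]
  -- Here p ⋅ u_t is at least τ times the smaller of cos t and sin(t - ω). The two forms o_ω = τ(1,
  -- 0) + u_{π/2} = τ v_ω + u_ω bound o_ω ⋅ u_t - 1 by τ times either of them.
  rcases le_total (Real.cos t) (Real.sin (t - ω)) with hle | hle
  · have : proj t (upperVertex ω) = τ * Real.cos t + Real.sin t := proj_upperVertex t
    nlinarith [Real.sin_le_one t]
  · have : proj t (upperVertex ω) = τ * Real.sin (t - ω) + Real.cos (t - ω) := by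
      have h1 : upperVertex ω = τ • v ω + u ω := by
        rw [← upperVertex_sub_u hω]; abel
      rw [h1, proj_add, proj_smul, proj_v]
      congr 1
      simp [proj, u, Real.cos_sub]; ring
    nlinarith [Real.cos_le_one (t - ω)]

end Triangle

/-- For these t, u_t is a nonnegative combination of u_ω and u_{π/2}, and o_ω maximizes both
coordinates over the parallelogram. -/
lemma proj_le_upperVertex {ω : ℝ} (hω : ω ∈ Ioo 0 (Real.pi / 2)) {p : Plane}
    (hp : p ∈ parallelogram ω) {t : ℝ} (ht : t ∈ Icc ω (Real.pi / 2)) :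
    proj t p ≤ proj t (upperVertex ω) := by
  have hpi := Real.pi_pos
  have hkc : 0 < Real.cos ω := Real.cos_pos_of_mem_Ioo ⟨by linarith [hω.1], hω.2⟩
  have c0 : 0 ≤ Real.cos t :=
    Real.cos_nonneg_of_neg_pi_div_two_le_of_le (by linarith [ht.1, hω.1]) ht.2
  have s0 : 0 ≤ Real.sin (t - ω) :=
    Real.sin_nonneg_of_nonneg_of_le_pi (by linarith [ht.1]) (by linarith [ht.2, hω.1])
  have key : ∀ q : Plane, Real.cos ω * proj t q =
      Real.cos t * proj ω q + Real.sin (t - ω) * q 1 := by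
    intro q; simp only [proj, Real.sin_sub]; ring
  rw [mem_parallelogram] at hp
  have h1 : proj ω (upperVertex ω) = 1 := by rw [proj_upperVertex, tan_mul_cos hω]; ring
  have h2 : upperVertex ω 1 = 1 := by simp [upperVertex]
  have e1 := key p
  have e2 := key (upperVertex ω)
  rw [h1, h2] at e2
  have : Real.cos ω * proj t p ≤ Real.cos ω * proj t (upperVertex ω) := by
    rw [e1, e2]
    gcongr
    · exact hp.2.2
    · exact hp.1.2
  exact le_of_mul_le_mul_left this hkc

/-- A monotone sofa whose rotation angle is `π/2`, or which avoids the triangle `Δ_ω`, is a moving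
sofa with rotation angle `π/2`. -/
lemma IsMonotoneSofa.isMovingSofa {ω : ℝ} {S : Set Plane} (hω : ω ∈ Ioc 0 (Real.pi / 2))
    (hS : IsMonotoneSofa ω S) (hΔ : ω < Real.pi / 2 → Disjoint S (triangle ω)) :
    IsMovingSofa S (Real.pi / 2) := by
  obtain ⟨S', h, hst, rfl⟩ := hS
  set S := monotonization ω S'
  have hcpt : IsCompact S := isCompact_monotonization hω
  have hconn : IsConnected S := isConnected_monotonization hω h hst
  have hpi := Real.pi_pos
  have hpar : ∀ p ∈ S, p ∈ parallelogram ω := fun p hp => (mem_monotonization.1 hp).1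
  have h1 : support S (Real.pi / 2) = 1 := by
    have := (support_monotonization hω h hst ⟨le_rfl, hω.1.le⟩).2
    rw [zero_add] at this
    exact this.trans hst.2
  -- For t beyond ω the sofa lies in a strip of width 1 normal to u_t, so it fits in the vertical
  -- arm of its supporting hallway.
  have hfan : ω < Real.pi / 2 → ∀ t ∈ Icc ω (Real.pi / 2), ∀ p ∈ S,
      support S t - 1 ≤ proj t p := by
    intro hlt t ht p hp
    have h2 : support S t ≤ proj t (upperVertex ω) :=
      support_le hconn.nonempty fun q hq => proj_le_upperVertex ⟨hω.1, hlt⟩ (hpar q hq) ht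
    have h3 := mem_parallelogram.1 (hpar p hp)
    have := sub_one_le_proj_of_notMem_triangle ⟨hω.1, hlt⟩
      (mem_fan.2 ⟨h3.2.1, h3.1.1⟩) (disjoint_left.1 (hΔ hlt) hp) ht
    linarith
  refine isMovingSofa_of_subset_supportingHallway (by positivity) hcpt hconn ?_ ?_ ?_
  · intro t ht p hp
    rcases le_or_gt t ω with hle | hgt
    · have hsup := support_monotonization hω h hst (t := t) ⟨ht.1, hle⟩
      have hm := mem_supportingHallway.1 ((mem_monotonization.1 hp).2 t ⟨ht.1, hle⟩)
      rw [mem_supportingHallway]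
      change _ ≤ support (monotonization ω S') _ ∧ _ ≤ support (monotonization ω S') _ ∧
        (support (monotonization ω S') _ - 1 ≤ _ ∨ support (monotonization ω S') _ - 1 ≤ _)
      rw [hsup.1, hsup.2]
      exact hm
    · rw [mem_supportingHallway]
      exact ⟨proj_le_support hcpt hp _, proj_le_support hcpt hp _,
        Or.inl (hfan (hgt.trans_le ht.2) t ⟨hgt.le, ht.2⟩ p hp)⟩
  · intro p hp
    rw [h1, sub_self]
    exact (mem_parallelogram.1 (hpar p hp)).1.1
  · intro p hp
    rw [h1, sub_self, proj_pi_div_two]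
    exact (mem_parallelogram.1 (hpar p hp)).1.1

/-- A monotone sofa avoids the niche of its cap. -/
lemma IsMonotoneSofa.disjoint_niche {ω : ℝ} {S : Set Plane} (hω : ω ∈ Ioc 0 (Real.pi / 2))
    (hS : IsMonotoneSofa ω S) (hK : (capOf ω S).Nonempty) :
    Disjoint S (niche ω (capOf ω S)) := by
  obtain ⟨S', h, hst, rfl⟩ := hS
  rw [disjoint_left]
  intro p hp hn
  obtain ⟨-, t, ht, hq⟩ := mem_niche.1 hn
  have ht' : t ∈ Icc 0 ω := ⟨ht.1.le, ht.2.le⟩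
  have hm := mem_supportingHallway.1 ((mem_monotonization.1 hp).2 t ht')
  rw [mem_innerQuadrant] at hq
  have hsup := support_monotonization hω h hst ht'
  -- The support values of the cap do not exceed those of `S'`, so its inner quadrants lie inside
  -- those that the sofa avoids.
  have e1 : support (capOf ω (monotonization ω S')) t ≤ support S' t :=
    support_le hK fun q hq => by
      rw [← hsup.1]; exact (mem_outerQuadrant.1 ((mem_capOf.1 hq).2 t ht')).1
  have e2 : support (capOf ω (monotonization ω S')) (t + Real.pi / 2) ≤
      support S' (t + Real.pi / 2) :=
    support_le hK fun q hq => by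
      rw [← hsup.2]; exact (mem_outerQuadrant.1 ((mem_capOf.1 hq).2 t ht')).2
  rcases hm.2.2 with e | e <;> linarith

lemma IsMonotoneSofa.subset_capOf {ω : ℝ} {S : Set Plane} (hω : ω ∈ Ioc 0 (Real.pi / 2))
    (hS : IsMonotoneSofa ω S) : S ⊆ capOf ω S := by
  obtain ⟨S', h, hst, rfl⟩ := hS
  have hcpt : IsCompact (monotonization ω S') := isCompact_monotonization hω
  exact fun p hp => mem_capOf.2 ⟨(mem_monotonization.1 hp).1, fun t ht =>
    mem_outerQuadrant.2 ⟨proj_le_support hcpt hp t, proj_le_support hcpt hp _⟩⟩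

/-! ### Area in the coordinates `(p ⋅ u_{π/2}, p ⋅ u_ω)` -/

section Area

variable {ω : ℝ}

/-- The linear map p ↦ (p ⋅ u_{π/2}, p ⋅ u_ω) has determinant -cos ω. In these coordinates P_ω is
the unit square. -/
lemma volume_preimage_strips (hω : 0 < Real.cos ω) (s : Set (ℝ × ℝ)) :
    volume {p : Plane | (p 1, proj ω p) ∈ s} = ENNReal.ofReal (Real.cos ω)⁻¹ * volume s := by
  set M : Matrix (Fin 2) (Fin 2) ℝ := !![0, 1; Real.cos ω, Real.sin ω] with hM
  have hdet : LinearMap.det (Matrix.toLin' M) = -Real.cos ω := by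
    rw [LinearMap.det_toLin', hM, Matrix.det_fin_two_of]; ring
  have e2 : MeasurePreserving (MeasurableEquiv.finTwoArrow (α := ℝ)) :=
    volume_preserving_finTwoArrow ℝ
  have e1 : MeasurePreserving (MeasurableEquiv.toLp 2 (Fin 2 → ℝ)).symm :=
    EuclideanSpace.volume_preserving_symm_measurableEquiv_toLp (Fin 2)
  have h : {p : Plane | (p 1, proj ω p) ∈ s} = (MeasurableEquiv.toLp 2 (Fin 2 → ℝ)).symm ⁻¹'
      ((Matrix.toLin' M) ⁻¹' (MeasurableEquiv.finTwoArrow ⁻¹' s)) := by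
    ext p
    simp [MeasurableEquiv.finTwoArrow, hM, Matrix.vecHead, Matrix.vecTail, proj,
      mul_comm]
  rw [h, e1.measure_preimage_equiv, Measure.addHaar_preimage_linearMap, e2.measure_preimage_equiv,
    hdet, inv_neg, abs_neg, abs_of_pos (inv_pos.2 hω)]
  rw [hdet]; linarith

lemma measurableSet_strips {s : Set (ℝ × ℝ)} (hs : MeasurableSet s) :
    MeasurableSet {p : Plane | (p 1, proj ω p) ∈ s} := by
  have : Continuous fun p : Plane => (p 1, proj ω p) :=
    Continuous.prodMk (by fun_prop) (continuous_proj ω)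
  exact this.measurable hs

/-- The parallelogram with `p ⋅ u_{π/2} ∈ I` and `p ⋅ u_ω ∈ J`. -/
def strips (ω : ℝ) (I J : Set ℝ) : Set Plane := {p | p 1 ∈ I ∧ proj ω p ∈ J}

lemma strips_eq (I J : Set ℝ) : strips ω I J = {p | (p 1, proj ω p) ∈ I ×ˢ J} := rfl

lemma volume_strips (hω : 0 < Real.cos ω) (I J : Set ℝ) :
    volume.real (strips ω I J) = (Real.cos ω)⁻¹ * (volume.real I * volume.real J) := by
  rw [strips_eq, measureReal_def, volume_preimage_strips hω, Measure.volume_eq_prod,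
    Measure.prod_prod]
  rw [ENNReal.toReal_mul, ENNReal.toReal_mul, ENNReal.toReal_ofReal (inv_nonneg.2 hω.le)]
  rfl

lemma isBounded_strips (hω : 0 < Real.cos ω) {a b c d : ℝ} :
    Bornology.IsBounded (strips ω (Icc a b) (Icc c d)) := by
  set Y := |a| + |b|
  set U := |c| + |d|
  refine isBounded_of_coord (M := Y + (U + Y) / Real.cos ω) fun p hp => ?_
  obtain ⟨⟨h1, h2⟩, h3, h4⟩ := hp
  have hY : |p 1| ≤ Y := by
    rw [abs_le]
    constructor <;> linarith [neg_abs_le a, le_abs_self b, abs_nonneg a, abs_nonneg b]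
  have hU : |proj ω p| ≤ U := by
    rw [abs_le]
    constructor <;> linarith [neg_abs_le c, le_abs_self d, abs_nonneg c, abs_nonneg d]
  have hY0 : 0 ≤ Y := by positivity
  have hU0 : 0 ≤ U := by positivity
  constructor
  · have : |p 0| ≤ (U + Y) / Real.cos ω := by
      rw [le_div_iff₀ hω]
      nth_rw 1 [← abs_of_pos hω]
      rw [← abs_mul, show p 0 * Real.cos ω = proj ω p - p 1 * Real.sin ω by unfold proj; ring]
      refine (abs_sub _ _).trans (add_le_add hU ?_)
      rw [abs_mul]
      exact (mul_le_of_le_one_right (abs_nonneg _) (Real.abs_sin_le_one ω)).trans hY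
    linarith
  · have : 0 ≤ (U + Y) / Real.cos ω := by positivity
    linarith

lemma isClosed_strips {a b c d : ℝ} : IsClosed (strips ω (Icc a b) (Icc c d)) :=
  (isClosed_Icc.preimage (by fun_prop : Continuous fun p : Plane => p 1)).inter
    (isClosed_Icc.preimage (continuous_proj ω))

lemma isCompact_strips (hω : 0 < Real.cos ω) {a b c d : ℝ} :
    IsCompact (strips ω (Icc a b) (Icc c d)) :=
  Metric.isCompact_of_isClosed_isBounded isClosed_strips (isBounded_strips hω)

end Area

/-! ### Caps -/

lemma IsCap.subset_parallelogram {ω : ℝ} {K : Set Plane} (h : IsCap ω K) : K ⊆ parallelogram ω := by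
  intro p hp
  have e1 := proj_le_support h.2.1 hp ω
  have e2 := proj_le_support h.2.1 hp (Real.pi / 2)
  have e3 := proj_le_support h.2.1 hp (ω + Real.pi)
  have e4 := proj_le_support h.2.1 hp (3 * Real.pi / 2)
  rw [h.2.2.2.1] at e1
  rw [h.2.2.2.2.1, proj_pi_div_two] at e2
  rw [h.2.2.2.2.2.1, proj_add_pi] at e3
  rw [h.2.2.2.2.2.2.1, proj_three_pi_div_two] at e4
  rw [mem_parallelogram]
  exact ⟨⟨by linarith, e2⟩, by linarith, e1⟩

lemma IsCap.subset_polygonCap {ω : ℝ} {K : Set Plane} (h : IsCap ω K) (Θ : Finset ℝ) :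
    K ⊆ polygonCap ω Θ K := fun _ hp =>
  mem_polygonCap.2 ⟨h.subset_parallelogram hp, fun _ _ =>
    mem_outerQuadrant.2 ⟨proj_le_support h.2.1 hp _, proj_le_support h.2.1 hp _⟩⟩

/-- Each half-plane cutting out `K` may be tightened to a supporting one, and its angle is either a
wall angle or that of a side of P_ω. So the first term of the area functional is the area of `K`. -/
lemma IsPolygonCap.polygonCap_eq {ω : ℝ} {K : Set Plane} {Θ : Finset ℝ}
    (h : IsPolygonCap ω Θ K) : polygonCap ω Θ K = K := by
  refine Subset.antisymm ?_ (h.1.subset_polygonCap Θ)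
  intro p hp
  obtain ⟨hpar, hΘ⟩ := mem_polygonCap.1 hp
  rw [mem_parallelogram] at hpar
  obtain ⟨hcap, I, hI, hK⟩ := h
  rw [hK, mem_iInter₂]
  intro i hi
  have hsup : support K i.1 ≤ i.2 := support_le hcap.1 fun q hq => by
    rw [hK, mem_iInter₂] at hq
    exact mem_halfPlane.1 (hq i hi)
  rw [mem_halfPlane]
  refine le_trans ?_ hsup
  rcases hI i hi with ((ht | ⟨t, ht, hti⟩) | ht) | ht
  · exact (mem_outerQuadrant.1 (hΘ _ ht)).1
  · rw [← hti]; exact (mem_outerQuadrant.1 (hΘ _ ht)).2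
  · rcases ht with ht | ht
    · rw [ht, hcap.2.2.2.1]; exact hpar.2.2
    · rw [ht, hcap.2.2.2.2.1, proj_pi_div_two]; exact hpar.1.2
  · rcases ht with ht | ht
    · rw [ht, hcap.2.2.2.2.2.1, proj_add_pi]; linarith
    · rw [ht, hcap.2.2.2.2.2.2.1, proj_three_pi_div_two]; linarith

lemma IsHalfPlaneIntersection.mono {A B : Set ℝ} {K : Set Plane} (h : IsHalfPlaneIntersection A K)
    (hAB : A ⊆ B) : IsHalfPlaneIntersection B K := by
  obtain ⟨I, hI, hK⟩ := h
  exact ⟨I, fun i hi => hAB (hI i hi), hK⟩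

/-- A polygon bounded by the sides of a translate of `P_ω` and walls with angles in
`Θ ∪ (Θ + π/2)`. -/
def wallPolygon (ω : ℝ) (Θ : Finset ℝ) (I J : Set ℝ) (h : ℝ → ℝ) : Set Plane :=
  {p | p ∈ strips ω I J ∧ ∀ t ∈ Θ, proj t p ≤ h t ∧ proj (t + Real.pi / 2) p ≤ h (t + Real.pi / 2)}

lemma isClosed_wallPolygon {ω : ℝ} {Θ : Finset ℝ} {a b c d : ℝ} {h : ℝ → ℝ} :
    IsClosed (wallPolygon ω Θ (Icc a b) (Icc c d) h) := by
  have : wallPolygon ω Θ (Icc a b) (Icc c d) h = strips ω (Icc a b) (Icc c d) ∩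
      ⋂ t ∈ Θ, ({p | proj t p ≤ h t} ∩ {p | proj (t + Real.pi / 2) p ≤ h (t + Real.pi / 2)}) := by
    ext p; simp only [wallPolygon, mem_inter_iff, mem_iInter₂]; rfl
  rw [this]
  exact isClosed_strips.inter (isClosed_biInter fun t _ =>
    (isClosed_le (continuous_proj _) continuous_const).inter
      (isClosed_le (continuous_proj _) continuous_const))

lemma wallPolygon_eq_iInter {ω : ℝ} {Θ : Finset ℝ} {h : ℝ → ℝ} :
    IsHalfPlaneIntersection ((Θ : Set ℝ) ∪ (fun t => t + Real.pi / 2) '' (Θ : Set ℝ) ∪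
      {ω, Real.pi / 2} ∪ {ω + Real.pi, 3 * Real.pi / 2})
      (wallPolygon ω Θ (Icc 0 1) (Icc 0 1) h) := by
  refine ⟨{i | (i.1 ∈ Θ ∧ i.2 = h i.1) ∨ (∃ t ∈ Θ, i.1 = t + Real.pi / 2 ∧ i.2 = h i.1) ∨
    (i.1 = ω ∧ i.2 = 1) ∨ (i.1 = Real.pi / 2 ∧ i.2 = 1) ∨ (i.1 = ω + Real.pi ∧ i.2 = 0) ∨
    (i.1 = 3 * Real.pi / 2 ∧ i.2 = 0)}, ?_, ?_⟩
  · rintro ⟨t, c⟩ (⟨h1, -⟩ | ⟨s, h1, h2, -⟩ | ⟨h1, -⟩ | ⟨h1, -⟩ | ⟨h1, -⟩ | ⟨h1, -⟩)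
    · exact Or.inl (Or.inl (Or.inl h1))
    · exact Or.inl (Or.inl (Or.inr ⟨s, h1, h2.symm⟩))
    · exact Or.inl (Or.inr (Or.inl h1))
    · exact Or.inl (Or.inr (Or.inr h1))
    · exact Or.inr (Or.inl h1)
    · exact Or.inr (Or.inr h1)
  · ext p
    simp only [mem_iInter₂, mem_halfPlane]
    constructor
    · rintro ⟨⟨⟨h1, h2⟩, h3, h4⟩, h5⟩ ⟨t, c⟩
        (⟨h6, h7⟩ | ⟨s, h6, h7, h8⟩ | ⟨h6, h7⟩ | ⟨h6, h7⟩ | ⟨h6, h7⟩ | ⟨h6, h7⟩) <;>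
        simp only at h6 h7 ⊢
      · rw [h7]; exact (h5 t h6).1
      · simp only at h8; rw [h8, h7]; exact (h5 s h6).2
      · rw [h6, h7]; exact h4
      · rw [h6, h7, proj_pi_div_two]; exact h2
      · rw [h6, h7, proj_add_pi]; linarith
      · rw [h6, h7, proj_three_pi_div_two]; linarith
    · intro hp
      have h1 := hp (ω, 1) (by simp)
      have h2 := hp (Real.pi / 2, 1) (by simp)
      have h3 := hp (ω + Real.pi, 0) (by simp)
      have h4 := hp (3 * Real.pi / 2, 0) (by simp)
      simp only [proj_pi_div_two, proj_add_pi, proj_three_pi_div_two] at h1 h2 h3 h4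
      refine ⟨⟨⟨by linarith, h2⟩, by linarith, h1⟩, fun t ht => ⟨?_, ?_⟩⟩
      · exact hp (t, h t) (Or.inl ⟨ht, rfl⟩)
      · exact hp (t + Real.pi / 2, h (t + Real.pi / 2)) (Or.inr (Or.inl ⟨t, ht, rfl, rfl⟩))

lemma convex_proj_le (t c : ℝ) : Convex ℝ {p : Plane | proj t p ≤ c} := by
  intro p hp q hq a b ha hb hab
  simp only [mem_ofPred_eq, proj_add, proj_smul] at *
  obtain rfl : b = 1 - a := by linarith
  nlinarith

lemma IsHalfPlaneIntersection.convex {A : Set ℝ} {K : Set Plane}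
    (h : IsHalfPlaneIntersection A K) : Convex ℝ K := by
  obtain ⟨I, -, rfl⟩ := h
  refine convex_iInter₂ fun i _ => ?_
  have : halfPlane i.1 i.2 = {p | proj i.1 p ≤ i.2} := by ext; exact mem_halfPlane
  rw [this]; exact convex_proj_le _ _

lemma IsCap.zero_mem {ω : ℝ} {K : Set Plane} (h : IsCap ω K)
    (hnn : ∀ t ∈ Icc 0 ω ∪ Icc (Real.pi / 2) (ω + Real.pi / 2), 0 ≤ support K t) :
    (0 : Plane) ∈ K := by
  obtain ⟨hne, hcpt, -, -, -, h3, h4, I, hI, hK⟩ := h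
  rw [hK, mem_iInter₂]
  intro i hi
  have hsup : support K i.1 ≤ i.2 := support_le hne fun q hq => by
    rw [hK, mem_iInter₂] at hq
    exact mem_halfPlane.1 (hq i hi)
  rw [mem_halfPlane, proj_origin]
  refine le_trans ?_ hsup
  rcases hI i hi with ht | ht
  · exact hnn _ ht
  · rcases ht with ht | ht
    · rw [ht, h3]
    · rw [ht, h4]

/-- A wall polygon that touches the four sides of the parallelogram is a polygon cap. -/
lemma isPolygonCap_wallPolygon {ω : ℝ} {Θ : Finset ℝ} {h : ℝ → ℝ} (hω : ω ∈ Ioo 0 (Real.pi / 2))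
    (hΘ : (Θ : Set ℝ) ⊆ Icc 0 ω)
    (h1 : ∃ p ∈ wallPolygon ω Θ (Icc 0 1) (Icc 0 1) h, proj ω p = 1)
    (h2 : ∃ p ∈ wallPolygon ω Θ (Icc 0 1) (Icc 0 1) h, p 1 = 1)
    (h3 : ∃ p ∈ wallPolygon ω Θ (Icc 0 1) (Icc 0 1) h, proj ω p = 0)
    (h4 : ∃ p ∈ wallPolygon ω Θ (Icc 0 1) (Icc 0 1) h, p 1 = 0) :
    IsPolygonCap ω Θ (wallPolygon ω Θ (Icc 0 1) (Icc 0 1) h) := by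
  have hkc : 0 < Real.cos ω :=
    Real.cos_pos_of_mem_Ioo ⟨by linarith [hω.1, Real.pi_pos], hω.2⟩
  refine ⟨⟨h1.imp fun p hp => hp.1, ?_, wallPolygon_eq_iInter.convex, ?_, ?_, ?_, ?_, ?_⟩,
    wallPolygon_eq_iInter⟩
  · exact (isCompact_strips hkc).of_isClosed_subset isClosed_wallPolygon fun p hp => hp.1
  · exact support_eq_of_forall_le (fun p hp => hp.1.2.2) h1
  · simp only [← proj_pi_div_two] at h2
    exact support_eq_of_forall_le (fun p hp => by rw [proj_pi_div_two]; exact hp.1.1.2) h2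
  · refine support_eq_of_forall_le (fun p hp => ?_) (h3.imp fun p hp => ⟨hp.1, ?_⟩)
    · rw [proj_add_pi]; linarith [hp.1.2.1]
    · rw [proj_add_pi, hp.2, neg_zero]
  · refine support_eq_of_forall_le (fun p hp => ?_) (h4.imp fun p hp => ⟨hp.1, ?_⟩)
    · rw [proj_three_pi_div_two]; linarith [hp.1.1.1]
    · rw [proj_three_pi_div_two, hp.2, neg_zero]
  · refine wallPolygon_eq_iInter.mono ?_
    rintro t (((ht | ⟨s, hs, rfl⟩) | ht) | ht)
    · exact Or.inl (Or.inl (hΘ ht))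
    · have := hΘ hs
      exact Or.inl (Or.inr ⟨by linarith [this.1], by linarith [this.2]⟩)
    · rcases ht with rfl | rfl
      · exact Or.inl (Or.inl ⟨hω.1.le, le_rfl⟩)
      · exact Or.inl (Or.inr ⟨le_rfl, by linarith [hω.1]⟩)
    · exact Or.inr ht

/-! ### Shifting the sides of a maximum polygon cap -/

/-- The region below inner walls with angles in `Θ ∪ (Θ + π/2)` in a translate of the fan. -/
def wallNiche (ω : ℝ) (Θ : Finset ℝ) (η κ : ℝ) (h : ℝ → ℝ) : Set Plane :=
  {p | (-η ≤ p 1 ∧ -κ ≤ proj ω p) ∧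
    ∃ t ∈ Θ, proj t p < h t - 1 ∧ proj (t + Real.pi / 2) p < h (t + Real.pi / 2) - 1}

lemma polygonNiche_eq_wallNiche (ω : ℝ) (Θ : Finset ℝ) (K : Set Plane) :
    polygonNiche ω Θ K = wallNiche ω Θ 0 0 (support K) := by
  ext p
  rw [mem_polygonNiche, mem_fan]
  simp only [mem_innerQuadrant, wallNiche, neg_zero, mem_ofPred_eq, and_comm]

/-- Both p ⋅ u_{π/2} and p ⋅ u_ω are combinations, with coefficients in [0, 1], of the projections
onto the two wall normals. Finiteness matters because `volume.real` sends infinite measure to 0. -/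
lemma volume_wallNiche_ne_top {ω : ℝ} (hω : ω ∈ Ioo 0 (Real.pi / 2)) {Θ : Finset ℝ}
    (hΘ : ∀ t ∈ Θ, t ∈ Ioo 0 ω) (η κ : ℝ) (h : ℝ → ℝ) :
    volume (wallNiche ω Θ η κ h) ≠ ⊤ := by
  have hpi := Real.pi_pos
  have hkc : 0 < Real.cos ω := Real.cos_pos_of_mem_Ioo ⟨by linarith [hω.1], hω.2⟩
  have : wallNiche ω Θ η κ h ⊆ ⋃ t ∈ Θ,
      strips ω (Icc (-η) (|h t - 1| + |h (t + Real.pi / 2) - 1|))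
        (Icc (-κ) (|h t - 1| + |h (t + Real.pi / 2) - 1|)) := by
    rintro p ⟨⟨h1, h2⟩, t, ht, h3, h4⟩
    have ht' := hΘ t ht
    rw [mem_iUnion₂]
    have s0 : 0 ≤ Real.sin t :=
      Real.sin_nonneg_of_nonneg_of_le_pi ht'.1.le (by linarith [ht'.2, hω.2])
    have c0 : 0 ≤ Real.cos t :=
      Real.cos_nonneg_of_neg_pi_div_two_le_of_le (by linarith [ht'.1]) (by linarith [ht'.2, hω.2])
    have s1 : 0 ≤ Real.sin (ω - t) :=
      Real.sin_nonneg_of_nonneg_of_le_pi (by linarith [ht'.2]) (by linarith [ht'.1, hω.2])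
    have c1 : 0 ≤ Real.cos (ω - t) :=
      Real.cos_nonneg_of_neg_pi_div_two_le_of_le (by linarith [ht'.2]) (by linarith [ht'.1, hω.2])
    have bound : ∀ {c x a : ℝ}, 0 ≤ c → c ≤ 1 → x < a → c * x ≤ |a| := by
      intro c x a hc hc1 hx
      have := le_abs_self a
      have := abs_nonneg a
      nlinarith
    have hcs := Real.sin_sq_add_cos_sq t
    have e1 : p 1 = Real.sin t * proj t p + Real.cos t * proj (t + Real.pi / 2) p := by
      rw [proj_add_pi_div_two]; unfold proj; linear_combination -(p 1) * hcs
    have e2 : proj ω p = Real.cos (ω - t) * proj t p +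
        Real.sin (ω - t) * proj (t + Real.pi / 2) p := by
      rw [proj_add_pi_div_two, Real.cos_sub, Real.sin_sub]; unfold proj
      linear_combination -(p 0 * Real.cos ω + p 1 * Real.sin ω) * hcs
    refine ⟨t, ht, ⟨h1, ?_⟩, h2, ?_⟩
    · rw [e1]
      exact add_le_add (bound s0 (Real.sin_le_one t) h3) (bound c0 (Real.cos_le_one t) h4)
    · rw [e2]
      exact add_le_add (bound c1 (Real.cos_le_one _) h3) (bound s1 (Real.sin_le_one _) h4)
  refine ((measure_mono this).trans_lt ?_).ne
  exact measure_biUnion_lt_top Θ.finite_toSet fun t _ => (isBounded_strips hkc).measure_lt_top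

lemma volume_real_preimage_sub (A : Set Plane) (d : Plane) :
    volume.real {p | p - d ∈ A} = volume.real A := by
  simp only [sub_eq_add_neg]
  exact congrArg ENNReal.toReal (measure_preimage_add_right volume (-d) A)

/-- Comparison of a maximum polygon cap with the polygon obtained by shifting the sides of the
parallelogram while keeping the walls. -/
lemma IsMaximumPolygonCap.shift_le {ω : ℝ} (hω : ω ∈ Ioo 0 (Real.pi / 2)) {Θ : Finset ℝ}
    (hΘ : ∀ t ∈ Θ, t ∈ Ioo 0 ω) {K : Set Plane} (hK : IsMaximumPolygonCap ω Θ K) {η κ : ℝ}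
    (h1 : ∃ p ∈ wallPolygon ω Θ (Icc (-η) (1 - η)) (Icc (-κ) (1 - κ)) (support K),
      proj ω p = 1 - κ)
    (h2 : ∃ p ∈ wallPolygon ω Θ (Icc (-η) (1 - η)) (Icc (-κ) (1 - κ)) (support K), p 1 = 1 - η)
    (h3 : ∃ p ∈ wallPolygon ω Θ (Icc (-η) (1 - η)) (Icc (-κ) (1 - κ)) (support K), proj ω p = -κ)
    (h4 : ∃ p ∈ wallPolygon ω Θ (Icc (-η) (1 - η)) (Icc (-κ) (1 - κ)) (support K), p 1 = -η) :
    volume.real (wallPolygon ω Θ (Icc (-η) (1 - η)) (Icc (-κ) (1 - κ)) (support K)) -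
      volume.real (wallNiche ω Θ η κ (support K)) ≤ polygonArea ω Θ K := by
  have hpi := Real.pi_pos
  have hkc : 0 < Real.cos ω := Real.cos_pos_of_mem_Ioo ⟨by linarith [hω.1], hω.2⟩
  -- The translation by `d` raises the two strip coordinates by η and κ, bringing the shifted
  -- polygon back to standard position.
  set d : Plane := !₂[(κ - η * Real.sin ω) / Real.cos ω, η] with hd
  have hd1 : d 1 = η := by simp [hd]
  have hdω : proj ω d = κ := by simp [hd, proj]; field_simp; ring
  set h' : ℝ → ℝ := fun t => support K t + proj t d
  set K' := wallPolygon ω Θ (Icc (-η) (1 - η)) (Icc (-κ) (1 - κ)) (support K)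
  set K'' := wallPolygon ω Θ (Icc 0 1) (Icc 0 1) h'
  have hmem : ∀ p, p ∈ K' ↔ p + d ∈ K'' := by
    intro p
    simp only [K', K'', wallPolygon, strips, mem_ofPred_eq, mem_Icc, PiLp.add_apply, hd1, hdω,
      proj_add, h', add_le_add_iff_right]
    refine and_congr_left fun _ => ?_
    constructor <;> rintro ⟨⟨e1, e2⟩, e3, e4⟩ <;>
      exact ⟨⟨by linarith, by linarith⟩, by linarith, by linarith⟩
  have hmem' : ∀ p, p ∈ K'' ↔ p - d ∈ K' := fun p => by rw [hmem, sub_add_cancel]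
  have hcap : IsPolygonCap ω Θ K'' := by
    refine isPolygonCap_wallPolygon hω (fun t ht => ⟨(hΘ t ht).1.le, (hΘ t ht).2.le⟩) ?_ ?_ ?_ ?_
    · obtain ⟨p, hp, hp'⟩ := h1
      exact ⟨p + d, (hmem p).1 hp, by rw [proj_add, hp', hdω]; ring⟩
    · obtain ⟨p, hp, hp'⟩ := h2
      exact ⟨p + d, (hmem p).1 hp, by rw [PiLp.add_apply, hp', hd1]; ring⟩
    · obtain ⟨p, hp, hp'⟩ := h3
      exact ⟨p + d, (hmem p).1 hp, by rw [proj_add, hp', hdω]; ring⟩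
    · obtain ⟨p, hp, hp'⟩ := h4
      exact ⟨p + d, (hmem p).1 hp, by rw [PiLp.add_apply, hp', hd1]; ring⟩
  refine le_trans ?_ (hK.2.2 K'' hcap)
  have e1 : volume.real K' = volume.real K'' := by
    rw [← volume_real_preimage_sub K' d]
    congr 1; ext p; exact (hmem' p).symm
  have e2 : volume.real K'' = volume.real (polygonCap ω Θ K'') := by rw [hcap.polygonCap_eq]
  -- Some walls may no longer touch the shifted polygon. Its support values can then only be smaller
  -- than the wall positions, which shrinks the niche.
  have e3 : volume.real (polygonNiche ω Θ K'') ≤ volume.real (wallNiche ω Θ η κ (support K)) := by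
    rw [← volume_real_preimage_sub (wallNiche ω Θ η κ (support K)) d]
    refine measureReal_mono ?_ ?_
    · intro p hp
      obtain ⟨hf, t, ht, hq⟩ := mem_polygonNiche.1 hp
      rw [mem_fan] at hf
      rw [mem_innerQuadrant] at hq
      have b1 : support K'' t ≤ h' t := support_le hcap.1.1 fun q hq => (hq.2 t ht).1
      have b2 : support K'' (t + Real.pi / 2) ≤ h' (t + Real.pi / 2) :=
        support_le hcap.1.1 fun q hq => (hq.2 t ht).2
      simp only [h'] at b1 b2
      refine ⟨⟨?_, ?_⟩, t, ht, ?_, ?_⟩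
      · rw [PiLp.sub_apply, hd1]; linarith [hf.2]
      · rw [proj_sub, hdω]; linarith [hf.1]
      · rw [proj_sub]; linarith [hq.1]
      · rw [proj_sub]; linarith [hq.2]
    · have := measure_preimage_add_right volume (-d) (wallNiche ω Θ η κ (support K))
      simp only [sub_eq_add_neg]
      exact this.trans_ne (volume_wallNiche_ne_top hω hΘ η κ _)
  rw [polygonArea, e1, e2]
  linarith

/-! ### Bounds for the support function of a cap -/

section Cap

variable {ω : ℝ} {K : Set Plane}

lemma proj_upperVertex_self (hω : ω ∈ Ioo 0 (Real.pi / 2)) : proj ω (upperVertex ω) = 1 := by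
  rw [proj_upperVertex, tan_mul_cos hω]; ring

lemma proj_upperVertex_perp (hω : ω ∈ Ioo 0 (Real.pi / 2)) :
    proj (ω + Real.pi / 2) (upperVertex ω) = Real.tan (Real.pi / 4 - ω / 2) := by
  have hkc : 0 < Real.cos ω :=
    Real.cos_pos_of_mem_Ioo ⟨by linarith [hω.1, Real.pi_pos], hω.2⟩
  rw [proj_add_pi_div_two]
  simp only [upperVertex, PiLp.toLp_apply, Matrix.cons_val_zero, Matrix.cons_val_one]
  apply mul_right_cancel₀ hkc.ne'
  linear_combination (-Real.sin ω - 1) * tan_mul_cos hω + Real.sin_sq_add_cos_sq ω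

/-- Support function bounds in terms of the value at `0`. -/
lemma IsCap.sin_mul_support_le (h : IsCap ω K) (hω : ω ∈ Ioo 0 (Real.pi / 2)) {t : ℝ}
    (ht : t ∈ Icc 0 ω) :
    Real.sin ω * support K t ≤ Real.sin (ω - t) * support K 0 + Real.sin t := by
  have hpi := Real.pi_pos
  obtain ⟨q, hq, hqt⟩ := exists_proj_eq_support h.2.1 h.1 t
  have s0 : 0 ≤ Real.sin t :=
    Real.sin_nonneg_of_nonneg_of_le_pi ht.1 (by linarith [ht.2, hω.2])
  have s1 : 0 ≤ Real.sin (ω - t) :=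
    Real.sin_nonneg_of_nonneg_of_le_pi (by linarith [ht.2]) (by linarith [ht.1, hω.2])
  rw [← hqt, sin_mul_proj]
  have e1 := proj_le_support h.2.1 hq 0
  have e2 := proj_le_support h.2.1 hq ω
  rw [h.2.2.2.1] at e2
  rw [proj_zero_left] at e1
  nlinarith

/-- Geometrically, the inner wall with normal angle t + π/2 meets the line of the fan edge along v_ω
at a coordinate at most h(ω + π/2). -/
lemma IsCap.support_perp_sub_one_le (h : IsCap ω K) (hω : ω ∈ Ioo 0 (Real.pi / 2)) {t : ℝ}
    (ht : t ∈ Icc 0 ω) :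
    support K (t + Real.pi / 2) - 1 ≤ support K (ω + Real.pi / 2) * Real.cos (ω - t) := by
  have hpi := Real.pi_pos
  obtain ⟨q, hq, hqt⟩ := exists_proj_eq_support h.2.1 h.1 (t + Real.pi / 2)
  have s1 : 0 ≤ Real.sin (ω - t) :=
    Real.sin_nonneg_of_nonneg_of_le_pi (by linarith [ht.2]) (by linarith [ht.1, hω.2])
  have c1 : 0 ≤ Real.cos (ω - t) :=
    Real.cos_nonneg_of_neg_pi_div_two_le_of_le (by linarith [ht.2]) (by linarith [ht.1, hω.2])
  have e : proj (t + Real.pi / 2) q = Real.cos (ω - t) * proj (ω + Real.pi / 2) q +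
      Real.sin (ω - t) * proj ω q := by
    simp only [proj_add_pi_div_two, Real.cos_sub, Real.sin_sub]; unfold proj
    linear_combination (q 0 * Real.sin t - q 1 * Real.cos t) * Real.sin_sq_add_cos_sq ω
  have e1 := proj_le_support h.2.1 hq (ω + Real.pi / 2)
  have e2 := proj_le_support h.2.1 hq ω
  have e3 := (mem_parallelogram.1 (h.subset_parallelogram hq)).2.1
  rw [h.2.2.2.1] at e2
  rw [← hqt, e]
  nlinarith [Real.sin_le_one (ω - t)]

lemma IsCap.support_zero_mul_cos_le (h : IsCap ω K) (hω : ω ∈ Ioo 0 (Real.pi / 2)) {t : ℝ}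
    (ht : t ∈ Icc 0 ω) : support K 0 * Real.cos t ≤ support K t := by
  obtain ⟨q, hq, hq0⟩ := exists_proj_eq_support h.2.1 h.1 0
  have s0 : 0 ≤ Real.sin t :=
    Real.sin_nonneg_of_nonneg_of_le_pi ht.1 (by linarith [ht.2, hω.2, Real.pi_pos])
  have e := proj_le_support h.2.1 hq t
  have e1 := (mem_parallelogram.1 (h.subset_parallelogram hq)).1.1
  rw [proj_zero_left] at hq0
  rw [← hq0]
  unfold proj at e
  nlinarith

lemma IsCap.support_perp_mul_cos_le (h : IsCap ω K) (hω : ω ∈ Ioo 0 (Real.pi / 2)) {t : ℝ}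
    (ht : t ∈ Icc 0 ω) :
    support K (ω + Real.pi / 2) * Real.cos (ω - t) ≤ support K (t + Real.pi / 2) := by
  have hpi := Real.pi_pos
  obtain ⟨q, hq, hq0⟩ := exists_proj_eq_support h.2.1 h.1 (ω + Real.pi / 2)
  have s1 : 0 ≤ Real.sin (ω - t) :=
    Real.sin_nonneg_of_nonneg_of_le_pi (by linarith [ht.2]) (by linarith [ht.1, hω.2])
  have e : proj (t + Real.pi / 2) q = Real.cos (ω - t) * proj (ω + Real.pi / 2) q +
      Real.sin (ω - t) * proj ω q := by
    simp only [proj_add_pi_div_two, Real.cos_sub, Real.sin_sub]; unfold proj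
    linear_combination (q 0 * Real.sin t - q 1 * Real.cos t) * Real.sin_sq_add_cos_sq ω
  have e2 := proj_le_support h.2.1 hq (t + Real.pi / 2)
  have e3 := (mem_parallelogram.1 (h.subset_parallelogram hq)).2.1
  rw [← hq0]
  nlinarith

/-- The vector o_ω bisects the cone between u_ω and u_{π/2}, so its projections onto all wall
normals are nonnegative and no half-plane of the cap can exclude the origin. -/
lemma IsCap.zero_mem_of_upperVertex_mem (h : IsCap ω K) (hω : ω ∈ Ioo 0 (Real.pi / 2))
    (ho : upperVertex ω ∈ K) : (0 : Plane) ∈ K := by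
  have hω' : ω ∈ Ioc 0 (Real.pi / 2) := ⟨hω.1, hω.2.le⟩
  have hτ := tan_pos hω
  refine h.zero_mem ?_
  have key := fun t (ht : t ∈ Icc 0 ω) => proj_nonneg_of_cone hω' ht (d := upperVertex ω)
    (by simpa [upperVertex] using hτ.le) (by rw [proj_upperVertex_perp hω]; exact hτ.le)
    (by simp [upperVertex])
  rintro t (ht | ht)
  · exact (key t ht).1.trans (proj_le_support h.2.1 ho t)
  · have := (key (t - Real.pi / 2) ⟨by linarith [ht.1], by linarith [ht.2]⟩).2
    rw [sub_add_cancel] at this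
    exact this.trans (proj_le_support h.2.1 ho t)

end Cap

lemma volume_strips_Icc_ne_top {ω : ℝ} (hω : 0 < Real.cos ω) (a b c d : ℝ) :
    volume (strips ω (Icc a b) (Icc c d)) ≠ ⊤ :=
  (isBounded_strips hω).measure_lt_top.ne

lemma proj_eq_comb (ω t : ℝ) (p : Plane) : proj t p =
    Real.cos (ω - t) * proj ω p - Real.sin (ω - t) * proj (ω + Real.pi / 2) p := by
  simp only [proj_add_pi_div_two, Real.cos_sub, Real.sin_sub]; unfold proj
  linear_combination (-(p 0 * Real.cos t) - p 1 * Real.sin t) * Real.sin_sq_add_cos_sq ω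

lemma proj_perp_eq_comb (ω t : ℝ) (p : Plane) : proj (t + Real.pi / 2) p =
    Real.cos (ω - t) * proj (ω + Real.pi / 2) p + Real.sin (ω - t) * proj ω p := by
  simp only [proj_add_pi_div_two, Real.cos_sub, Real.sin_sub]; unfold proj
  linear_combination (p 0 * Real.sin t - p 1 * Real.cos t) * Real.sin_sq_add_cos_sq ω

lemma coord_one_eq_comb (ω : ℝ) (p : Plane) :
    p 1 = Real.cos ω * proj (ω + Real.pi / 2) p + Real.sin ω * proj ω p := by
  rw [proj_add_pi_div_two]; unfold proj; linear_combination -(p 1) * Real.sin_sq_add_cos_sq ω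

lemma trig_pos {ω t : ℝ} (hω : ω ∈ Ioo 0 (Real.pi / 2)) (ht : t ∈ Ioo 0 ω) :
    0 < Real.sin t ∧ 0 < Real.cos t ∧ 0 < Real.sin (ω - t) ∧ 0 < Real.cos (ω - t) := by
  have hpi := Real.pi_pos
  exact ⟨Real.sin_pos_of_pos_of_lt_pi ht.1 (by linarith [ht.2, hω.2]),
      Real.cos_pos_of_mem_Ioo ⟨by linarith [ht.1], by linarith [ht.2, hω.2]⟩,
      Real.sin_pos_of_pos_of_lt_pi (by linarith [ht.2]) (by linarith [ht.1, hω.2]),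
      Real.cos_pos_of_mem_Ioo ⟨by linarith [ht.2], by linarith [ht.1, hω.2]⟩⟩

lemma cos_pos_of_mem {ω : ℝ} (hω : ω ∈ Ioo 0 (Real.pi / 2)) : 0 < Real.cos ω :=
  Real.cos_pos_of_mem_Ioo ⟨by linarith [hω.1, Real.pi_pos], hω.2⟩

lemma sin_pos_of_mem {ω : ℝ} (hω : ω ∈ Ioo 0 (Real.pi / 2)) : 0 < Real.sin ω :=
  Real.sin_pos_of_pos_of_lt_pi hω.1 (by linarith [hω.2, Real.pi_pos])

/-! ### Areas gained when the sides of the parallelogram are shifted -/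

section PolygonCap

variable {ω : ℝ} {Θ : Finset ℝ} {K : Set Plane}

lemma IsPolygonCap.mem_of_walls (hK : IsPolygonCap ω Θ K) {p : Plane} (hp : p ∈ parallelogram ω)
    (hpt : ∀ t ∈ Θ, proj t p ≤ support K t ∧
      proj (t + Real.pi / 2) p ≤ support K (t + Real.pi / 2)) : p ∈ K := by
  rw [← hK.polygonCap_eq]
  exact mem_polygonCap.2 ⟨hp, fun t ht => mem_outerQuadrant.2 (hpt t ht)⟩

lemma IsCap.cos_mul_support_zero_le (hcap : IsCap ω K) (hω : ω ∈ Ioo 0 (Real.pi / 2)) :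
    Real.cos ω * support K 0 ≤ 1 := by
  have := hcap.support_zero_mul_cos_le hω ⟨hω.1.le, le_rfl⟩
  rw [hcap.2.2.2.1] at this
  linarith

lemma IsCap.cos_mul_support_perp_le (hcap : IsCap ω K) (hω : ω ∈ Ioo 0 (Real.pi / 2)) :
    Real.cos ω * support K (ω + Real.pi / 2) ≤ 1 := by
  have := hcap.support_perp_mul_cos_le hω (t := 0) ⟨le_rfl, hω.1.le⟩
  rw [zero_add, hcap.2.2.2.2.1, sub_zero] at this
  linarith

lemma IsPolygonCap.bottom_vertex_mem (hω : ω ∈ Ioo 0 (Real.pi / 2)) (hΘ : ∀ t ∈ Θ, t ∈ Ioo 0 ω)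
    (hK : IsPolygonCap ω Θ K) (hnn : ∀ t, 0 ≤ support K t) :
    (!₂[support K 0, 0] : Plane) ∈ K := by
  have h1 := hK.1.cos_mul_support_zero_le hω
  have h0 := hnn 0
  have hk := cos_pos_of_mem hω
  refine hK.mem_of_walls ?_ fun t ht => ⟨?_, ?_⟩
  · rw [mem_parallelogram]
    simp [proj]
    exact ⟨by positivity, by linarith⟩
  · simpa [proj] using hK.1.support_zero_mul_cos_le hω ⟨(hΘ t ht).1.le, (hΘ t ht).2.le⟩
  · have := hnn (t + Real.pi / 2)
    have := mul_nonneg h0 (trig_pos hω (hΘ t ht)).1.le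
    rw [proj_add_pi_div_two]
    simp
    linarith

/-- Points slightly below the bottom side satisfy the walls. -/
lemma IsCap.below_bottom (hω : ω ∈ Ioo 0 (Real.pi / 2)) (hcap : IsCap ω K)
    (hnn : ∀ t, 0 ≤ support K t) {p : Plane} {η : ℝ} (h1 : -η ≤ p 1) (h2 : p 1 ≤ 0)
    (h3 : 0 ≤ proj ω p) (h4 : proj ω p ≤ Real.cos ω * support K 0 - η * Real.sin ω)
    {t : ℝ} (ht : t ∈ Ioo 0 ω) : proj t p ≤ support K t ∧
      proj (t + Real.pi / 2) p ≤ support K (t + Real.pi / 2) := by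
  have hk := cos_pos_of_mem hω
  have hs := sin_pos_of_mem hω
  obtain ⟨st, ct, -⟩ := trig_pos hω ht
  have hx : p 0 * Real.cos ω = proj ω p - p 1 * Real.sin ω := by unfold proj; ring
  have hys := mul_nonneg (neg_nonneg.2 h2) hs.le
  have hys' := mul_nonneg (show 0 ≤ p 1 + η by linarith) hs.le
  have hx0 : 0 ≤ p 0 := by
    refine nonneg_of_mul_nonneg_left ?_ hk
    linarith
  have hx1 : p 0 ≤ support K 0 := by
    refine le_of_mul_le_mul_right ?_ hk
    linarith
  have e1 := hcap.support_zero_mul_cos_le hω ⟨ht.1.le, ht.2.le⟩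
  have e2 := mul_le_mul_of_nonneg_right hx1 ct.le
  have e3 := mul_nonneg (neg_nonneg.2 h2) st.le
  have e4 := mul_nonneg (neg_nonneg.2 h2) ct.le
  have e5 := mul_nonneg hx0 st.le
  have := hnn (t + Real.pi / 2)
  rw [proj_add_pi_div_two]
  unfold proj
  constructor <;> linarith

/-- Points slightly beyond the lower left side satisfy the walls. -/
lemma IsCap.beyond_left (hω : ω ∈ Ioo 0 (Real.pi / 2)) (hcap : IsCap ω K)
    (hnn : ∀ t, 0 ≤ support K t) {p : Plane} {κ : ℝ} (h1 : -κ ≤ proj ω p) (h2 : proj ω p ≤ 0)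
    (h3 : 0 ≤ p 1) (h4 : p 1 ≤ Real.cos ω * support K (ω + Real.pi / 2) - κ * Real.sin ω)
    {t : ℝ} (ht : t ∈ Ioo 0 ω) : proj t p ≤ support K t ∧
      proj (t + Real.pi / 2) p ≤ support K (t + Real.pi / 2) := by
  have hk := cos_pos_of_mem hω
  have hs := sin_pos_of_mem hω
  obtain ⟨-, -, st, ct⟩ := trig_pos hω ht
  have hV := coord_one_eq_comb ω p
  have hys := mul_nonneg (neg_nonneg.2 h2) hs.le
  have hys' := mul_nonneg (show 0 ≤ proj ω p + κ by linarith) hs.le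
  have hx0 : 0 ≤ proj (ω + Real.pi / 2) p := by
    refine nonneg_of_mul_nonneg_right (b := proj (ω + Real.pi / 2) p) ?_ hk
    linarith
  have hx1 : proj (ω + Real.pi / 2) p ≤ support K (ω + Real.pi / 2) := by
    refine le_of_mul_le_mul_left ?_ hk
    linarith
  have e1 := hcap.support_perp_mul_cos_le hω ⟨ht.1.le, ht.2.le⟩
  have e2 := mul_le_mul_of_nonneg_right hx1 ct.le
  have e3 := mul_nonneg (neg_nonneg.2 h2) st.le
  have e4 := mul_nonneg (neg_nonneg.2 h2) ct.le
  have e5 := mul_nonneg hx0 st.le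
  have := hnn t
  rw [proj_perp_eq_comb ω t p, proj_eq_comb ω t p]
  constructor <;> linarith

/-- New points lie below the horizontal edge of the fan or beyond its slanted edge. By `ha` the
inner walls meet the horizontal axis at abscissa at most `a`; down to depth η they drift right by at
most η tan ω, which is η sin ω in the coordinate p ⋅ u_ω. The slanted edge is treated in the same
way. -/
lemma IsCap.wallNiche_subset (hω : ω ∈ Ioo 0 (Real.pi / 2)) (hΘ : ∀ t ∈ Θ, t ∈ Ioo 0 ω)
    (hcap : IsCap ω K) {a η κ : ℝ} (hη : 0 ≤ η) (hκ : 0 ≤ κ)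
    (ha : ∀ t ∈ Θ, support K t - 1 ≤ a * Real.cos t) :
    wallNiche ω Θ η κ (support K) ⊆ wallNiche ω Θ 0 0 (support K) ∪
      strips ω (Icc (-η) 0) (Icc (-κ) (Real.cos ω * a + η * Real.sin ω)) ∪
      strips ω (Icc 0 (Real.cos ω * support K (ω + Real.pi / 2) + κ * Real.sin ω))
        (Icc (-κ) 0) := by
  have hk := cos_pos_of_mem hω
  have hs := sin_pos_of_mem hω
  -- a point below a line of slope steeper than that of the side of the parallelogram
  have slope : ∀ {x c d δ : ℝ}, 0 ≤ δ → 0 < d → c * Real.cos ω ≤ d * Real.sin ω →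
      x * d < δ * c → x * Real.cos ω ≤ δ * Real.sin ω := by
    intro x c d δ hδ hd hcd hx
    refine le_of_mul_le_mul_right ?_ hd
    have a1 := mul_le_mul_of_nonneg_right hx.le hk.le
    have a2 := mul_le_mul_of_nonneg_left hcd hδ
    linarith
  rintro p ⟨⟨h1, h2⟩, t, ht, h3, h4⟩
  have ht' := hΘ t ht
  obtain ⟨st, ct, sωt, cωt⟩ := trig_pos hω ht'
  rcases lt_or_ge (p 1) 0 with hy | hy
  · refine Or.inl (Or.inr ⟨⟨h1, hy.le⟩, h2, ?_⟩)
    have hb := ha t ht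
    have hx : (p 0 - a) * Real.cos t < η * Real.sin t := by
      have := mul_nonneg (show 0 ≤ p 1 + η by linarith) st.le
      unfold proj at h3
      linarith
    have hx' := slope hη ct (by rw [Real.sin_sub] at sωt; linarith) hx
    have := mul_nonneg (neg_nonneg.2 hy.le) hs.le
    unfold proj
    linarith
  · rcases lt_or_ge (proj ω p) 0 with hU | hU
    · refine Or.inr ⟨⟨hy, ?_⟩, h2, hU.le⟩
      have hb := hcap.support_perp_sub_one_le hω ⟨ht'.1.le, ht'.2.le⟩
      have hV := coord_one_eq_comb ω p
      have hx : (proj (ω + Real.pi / 2) p - support K (ω + Real.pi / 2)) * Real.cos (ω - t) <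
          κ * Real.sin (ω - t) := by
        rw [proj_perp_eq_comb ω t p] at h4
        have := mul_nonneg (show 0 ≤ proj ω p + κ by linarith) sωt.le
        linarith
      have hst : Real.sin (ω - t) * Real.cos ω ≤ Real.cos (ω - t) * Real.sin ω := by
        have := st.le
        rw [show t = ω - (ω - t) by ring, Real.sin_sub] at this
        linarith
      have hx' := slope hκ cωt hst hx
      have := mul_nonneg (neg_nonneg.2 hU.le) hs.le
      linarith
    · exact Or.inl (Or.inl ⟨⟨by linarith, by linarith⟩, t, ht, h3, h4⟩)

end PolygonCap

set_option maxHeartbeats 1000000 in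
/-- The top side of a maximum polygon cap extends at least as far to the left of the vertex of the
parallelogram as the bottom side extends beyond all the inner walls. -/
lemma IsMaximumPolygonCap.top_side_mem {ω : ℝ} (hω : ω ∈ Ioo 0 (Real.pi / 2)) {Θ : Finset ℝ}
    (hΘ : ∀ t ∈ Θ, t ∈ Ioo 0 ω) {K : Set Plane} (hK : IsMaximumPolygonCap ω Θ K) {B : ℝ}
    (hB0 : 0 ≤ B) (hBw : B ≤ support K 0)
    (hB : ∀ t ∈ Θ, support K t - 1 ≤ (support K 0 - B) * Real.cos t) :
    (!₂[Real.tan (Real.pi / 4 - ω / 2) - B, 1] : Plane) ∈ K := by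
  have hcap := hK.1.1
  have hcpt := hcap.2.1
  have ho := hK.2.1
  have h0 := hcap.zero_mem_of_upperVertex_mem hω ho
  have hτk := tan_mul_cos hω
  have hτ0 := tan_pos hω
  have hUo := proj_upperVertex_self hω
  have hVo := proj_upperVertex_perp hω
  have hk := cos_pos_of_mem hω
  have hs := sin_pos_of_mem hω
  have hs1 : Real.sin ω ≤ 1 := Real.sin_le_one ω
  have hcs := Real.sin_sq_add_cos_sq ω
  have hpoly := hK.1.polygonCap_eq
  have hmemK := fun p => hK.1.mem_of_walls (p := p)
  have hwall : ∀ p ∈ K, ∀ t ∈ Θ, proj t p ≤ support K t ∧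
      proj (t + Real.pi / 2) p ≤ support K (t + Real.pi / 2) := fun p hp t _ =>
    ⟨proj_le_support hcpt hp _, proj_le_support hcpt hp _⟩
  have hnn : ∀ t, 0 ≤ support K t := fun t => by
    simpa [proj_origin] using proj_le_support hcpt h0 t
  have hpar : ∀ p ∈ K, (0 ≤ p 1 ∧ p 1 ≤ 1) ∧ 0 ≤ proj ω p ∧ proj ω p ≤ 1 := fun p hp =>
    mem_parallelogram.1 (hcap.subset_parallelogram hp)
  set τ := Real.tan (Real.pi / 4 - ω / 2) with hτ
  set k := Real.cos ω with hkdef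
  set s := Real.sin ω with hsdef
  set w₁ := support K 0 with hw₁
  set w₂ := support K (ω + Real.pi / 2) with hw₂
  have hτw₁ : τ ≤ w₁ := by
    have := proj_le_support hcpt ho 0
    simpa [proj_zero_left, upperVertex] using this
  have hτw₂ : τ ≤ w₂ := by
    have := proj_le_support hcpt ho (ω + Real.pi / 2)
    rwa [hVo] at this
  have hb₁ := hK.1.bottom_vertex_mem hω hΘ hnn
  have hkw₁ := hcap.cos_mul_support_zero_le hω
  have hkw₂ := hcap.cos_mul_support_perp_le hω
  rw [← hw₁] at hb₁ hkw₁
  rw [← hw₂] at hkw₂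
  -- If the point is missing, the top side is shorter than B, and a small downward shift of the
  -- horizontal strip increases the area functional.
  by_contra hcon
  -- the wall that cuts off the point
  obtain ⟨t₀, ht₀, hcut⟩ : ∃ t ∈ Θ, support K (t + Real.pi / 2) <
      -((τ - B) * Real.sin t) + Real.cos t := by
    by_contra! hall
    refine hcon (hmemK _ ?_ fun t ht => ⟨?_, ?_⟩)
    · rw [mem_parallelogram]
      have e : proj ω (!₂[τ - B, 1] : Plane) = 1 - k * B := by
        simp [proj]; linear_combination hτk
      rw [e]
      have : k * B ≤ k * w₁ := mul_le_mul_of_nonneg_left hBw hk.le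
      have : 0 ≤ k * B := mul_nonneg hk.le hB0
      simp
      constructor <;> linarith
    · have := proj_le_support hcpt ho t
      rw [proj_upperVertex] at this
      simp [proj]
      have := mul_nonneg hB0 (trig_pos hω (hΘ t ht)).2.1.le
      linarith
    · have := hall t ht
      rw [proj_add_pi_div_two]
      simpa using this
  obtain ⟨st₀, ct₀, -⟩ := trig_pos hω (hΘ t₀ ht₀)
  set S := Real.sin t₀
  -- The cutting wall leaves a top side shorter than B by at least ε / S; measured in the coordinate
  -- p ⋅ u_ω this deficit is `e`.
  set ε := -((τ - B) * S) + Real.cos t₀ - support K (t₀ + Real.pi / 2) with hε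
  have hε0 : 0 < ε := by rw [hε]; linarith
  set e := k * ε / S with he
  have he0 : 0 < e := by positivity
  set c := k / S + s with hc
  have hc0 : 0 < c := by positivity
  have hs_lt : s < 1 := by nlinarith
  -- The second-order errors add up to at most (c + 6)η², which must stay below the first-order gain
  -- ηe. The second bound keeps all strips below nonempty, since τk = 1 - s.
  set η := min (e / (2 * (c + 6))) ((1 - s) / 2) with hη
  have hη0 : 0 < η := lt_min (by positivity) (by linarith)
  have hηe : (c + 6) * η ≤ e / 2 := by
    have : η ≤ e / (2 * (c + 6)) := min_le_left _ _
    rw [le_div_iff₀ (by positivity)] at this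
    linarith
  have hηs : 2 * η ≤ 1 - s := by
    have : η ≤ (1 - s) / 2 := min_le_right _ _
    linarith
  -- the shift of the other side
  set M := K ∩ {p : Plane | p 1 ≤ 1 - η} with hM
  have hMcl : IsClosed {p : Plane | p 1 ≤ 1 - η} :=
    isClosed_le (by fun_prop) continuous_const
  have hMc : IsCompact M := hcpt.inter_right hMcl
  have hoM : (1 - η) • upperVertex ω ∈ M := by
    refine ⟨?_, ?_⟩
    · have := hcap.2.2.1 ho h0 (show 0 ≤ 1 - η by linarith) hη0.le (sub_add_cancel 1 η)
      simpa using this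
    · simp [upperVertex]
  obtain ⟨q, hqM, hqmax⟩ := hMc.exists_isMaxOn ⟨_, hoM⟩ (continuous_proj ω).continuousOn
  have hqmax' : ∀ p ∈ M, proj ω p ≤ proj ω q := fun p hp => hqmax hp
  -- Truncation at height 1 - η may remove every point with p ⋅ u_ω = 1. Lowering the other strip by
  -- exactly κ restores contact with its upper edge and removes nothing from `M`.
  set κ := 1 - proj ω q with hκ
  have hκ0 : 0 ≤ κ := by linarith [(hpar q hqM.1).2.2]
  have hκη : κ ≤ η := by
    have := hqmax' _ hoM
    rw [proj_smul, hUo] at this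
    linarith
  have hMκ : ∀ p ∈ M, proj ω p ≤ 1 - κ := fun p hp => by linarith [hqmax' p hp]
  set K' := wallPolygon ω Θ (Icc (-η) (1 - η)) (Icc (-κ) (1 - κ)) (support K) with hK'
  have hMK' : M ⊆ K' := fun p hp => ⟨⟨⟨by linarith [(hpar p hp.1).1.1], hp.2⟩,
    by linarith [(hpar p hp.1).2.1], hMκ p hp⟩, hwall p hp.1⟩
  have hb₁M : (!₂[w₁, 0] : Plane) ∈ M := ⟨hb₁, by simp; linarith⟩
  have hkw₁κ : k * w₁ ≤ 1 - κ := by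
    have := hMκ _ hb₁M
    simp [proj] at this
    linarith
  have hηs' : η * s ≤ η := mul_le_of_le_one_right hη0.le hs1
  have hκs' : κ * s ≤ κ := mul_le_of_le_one_right hκ0 hs1
  have hkτ₁ : τ * k ≤ k * w₁ := by
    rw [mul_comm]; exact mul_le_mul_of_nonneg_left hτw₁ hk.le
  have hkτ₂ : τ * k ≤ k * w₂ := by
    rw [mul_comm]; exact mul_le_mul_of_nonneg_left hτw₂ hk.le
  have hR₁ : ∀ p : Plane, -η ≤ p 1 → p 1 ≤ 0 → 0 ≤ proj ω p → proj ω p ≤ k * w₁ - η * s →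
      p ∈ K' := fun p h1 h2 h3 h4 => ⟨⟨⟨h1, by linarith⟩, by linarith,
        by linarith [mul_nonneg hη0.le hs.le]⟩,
      fun t ht => hcap.below_bottom hω hnn h1 h2 h3 h4 (hΘ t ht)⟩
  have hR₂ : ∀ p : Plane, -κ ≤ proj ω p → proj ω p ≤ 0 → 0 ≤ p 1 → p 1 ≤ k * w₂ - κ * s - η →
      p ∈ K' := fun p h1 h2 h3 h4 => ⟨⟨⟨by linarith, by linarith [mul_nonneg hκ0 hs.le]⟩, h1,
        by linarith⟩,
      fun t ht => hcap.beyond_left hω hnn h1 h2 h3 (h4.trans (by linarith)) (hΘ t ht)⟩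
  have hshift := hK.shift_le hω hΘ (η := η) (κ := κ)
    ⟨q, hMK' hqM, by rw [hκ]; ring⟩
    ⟨_, hMK' hoM, by simp [upperVertex]⟩
    ⟨(-κ) • u ω, by
      have hu : ∀ t, proj t (u ω) = Real.cos (ω - t) := by
        intro t; simp [proj, u, Real.cos_sub]
      refine ⟨⟨⟨?_, ?_⟩, ?_, ?_⟩, fun t ht => ?_⟩
      · simp [u]; linarith
      · simp [u]; linarith [mul_nonneg hκ0 hs.le]
      · rw [proj_smul, hu, sub_self, Real.cos_zero]; linarith
      · rw [proj_smul, hu, sub_self, Real.cos_zero]; linarith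
      · obtain ⟨st, ct, sωt, cωt⟩ := trig_pos hω (hΘ t ht)
        rw [proj_smul, proj_smul, hu, hu,
          show ω - (t + Real.pi / 2) = -(Real.pi / 2 - (ω - t)) by ring, Real.cos_neg,
          Real.cos_pi_div_two_sub]
        have := hnn t
        have := hnn (t + Real.pi / 2)
        have := mul_nonneg hκ0 sωt.le
        have := mul_nonneg hκ0 cωt.le
        constructor <;> linarith,
      by
        have hu : proj ω (u ω) = 1 := by
          simp only [proj, u, PiLp.toLp_apply, Matrix.cons_val_zero, Matrix.cons_val_one]
          linear_combination Real.sin_sq_add_cos_sq ω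
        rw [proj_smul, hu]; ring⟩
    ⟨!₂[η * s / k, -η], by
      have hz : proj ω (!₂[η * s / k, -η] : Plane) = 0 := by
        simp only [proj, Matrix.cons_val_zero, Matrix.cons_val_one,
          ← hkdef, ← hsdef]
        field_simp; ring
      refine hR₁ _ (by simp) (by simpa using hη0.le) hz.ge ?_
      rw [hz]
      linarith, by simp⟩
  rw [← hK', polygonArea, hpoly, polygonNiche_eq_wallNiche] at hshift
  -- the area of the new polygon
  set R₁ := strips ω (Ico (-η) 0) (Icc 0 (k * w₁ - η * s)) with hR₁def
  set R₂ := strips ω (Icc 0 (k * w₂ - κ * s - η)) (Ico (-κ) 0) with hR₂def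
  have hmeas : ∀ {I J : Set ℝ}, MeasurableSet I → MeasurableSet J →
      MeasurableSet (strips ω I J) := fun hI hJ => measurableSet_strips (hI.prod hJ)
  have hfin : volume K' ≠ ⊤ :=
    measure_ne_top_of_subset (fun p hp => hp.1) (volume_strips_Icc_ne_top hk _ _ _ _)
  have hsub₁ : R₁ ⊆ K' := fun p hp => hR₁ p hp.1.1 hp.1.2.le hp.2.1 hp.2.2
  have hsub₂ : R₂ ⊆ K' := fun p hp => hR₂ p hp.2.1 hp.2.2.le hp.1.1 hp.1.2
  have areaK' : volume.real M + volume.real R₁ + volume.real R₂ ≤ volume.real K' := by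
    have d1 : Disjoint M R₁ := disjoint_left.2 fun p hp hp' => by
      linarith [(hpar p hp.1).1.1, hp'.1.2]
    have d2 : Disjoint (M ∪ R₁) R₂ := disjoint_left.2 fun p hp hp' => by
      rcases hp with hp | hp
      · linarith [(hpar p hp.1).2.1, hp'.2.2]
      · linarith [hp.2.1, hp'.2.2]
    rw [← measureReal_union d1 (hmeas measurableSet_Ico measurableSet_Icc)
        (measure_ne_top_of_subset hMK' hfin) (measure_ne_top_of_subset hsub₁ hfin),
      ← measureReal_union d2 (hmeas measurableSet_Icc measurableSet_Ico)
        (measure_ne_top_of_subset (union_subset hMK' hsub₁) hfin)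
        (measure_ne_top_of_subset hsub₂ hfin)]
    exact measureReal_mono (union_subset (union_subset hMK' hsub₁) hsub₂) hfin
  have areaR₁ : volume.real R₁ = k⁻¹ * (η * (k * w₁ - η * s)) := by
    rw [hR₁def, volume_strips hk, Real.volume_real_Ico_of_le (by linarith),
      Real.volume_real_Icc_of_le (by linarith)]
    ring
  have areaR₂ : volume.real R₂ = k⁻¹ * (κ * (k * w₂ - κ * s - η)) := by
    rw [hR₂def, volume_strips hk, Real.volume_real_Ico_of_le (by linarith),
      Real.volume_real_Icc_of_le (by linarith)]
    ring
  -- the area of the removed top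
  set T := strips ω (Icc (1 - η) 1) (Icc (1 - k * B + e - c * η) 1) with hT
  have hKT : K ⊆ M ∪ T := by
    intro p hp
    rcases le_or_gt (p 1) (1 - η) with hle | hgt
    · exact Or.inl ⟨hp, hle⟩
    · right
      have hp' := hpar p hp
      refine ⟨⟨hgt.le, hp'.1.2⟩, ?_, hp'.2.2⟩
      have h1 := (hwall p hp t₀ ht₀).2
      rw [proj_add_pi_div_two] at h1
      have h2 : (τ - B) * S + ε - η ≤ p 0 * S := by
        have a1 := mul_le_mul_of_nonneg_right hgt.le ct₀.le
        have a2 := mul_le_of_le_one_right hη0.le (Real.cos_le_one t₀)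
        linarith
      have h3 : (τ - B) + (ε - η) / S ≤ p 0 := by
        refine le_of_mul_le_mul_right (le_trans (le_of_eq ?_) h2) st₀
        field_simp
        ring
      have h4 : k * ((τ - B) + (ε - η) / S) ≤ p 0 * k := by
        rw [mul_comm (p 0)]; exact mul_le_mul_of_nonneg_left h3 hk.le
      have h5 : s * (1 - η) ≤ p 1 * s := by
        rw [mul_comm (p 1)]; exact mul_le_mul_of_nonneg_left hgt.le hs.le
      have h6 : 1 - k * B + e - c * η = k * ((τ - B) + (ε - η) / S) + s * (1 - η) := by
        rw [he, hc]; linear_combination -hτk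
      rw [h6]; unfold proj; linarith
  -- The vertex o_ω lies in `K` but not in `M`, so it lies in `T`; hence the interval defining `T`
  -- is not reversed and its length is the difference of its endpoints.
  have hpos : 0 ≤ k * B - e + c * η := by
    rcases hKT ho with h | h
    · have := h.2
      simp [upperVertex] at this
      linarith
    · have := h.2.1
      rw [hUo] at this
      linarith
  have areaK : volume.real K ≤ volume.real M + k⁻¹ * (η * (k * B - e + c * η)) := by
    have hT' : volume.real T = k⁻¹ * (η * (k * B - e + c * η)) := by
      rw [hT, volume_strips hk, Real.volume_real_Icc_of_le (by linarith),
        Real.volume_real_Icc_of_le (by linarith)]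
      ring
    rw [← hT']
    exact (measureReal_mono hKT (measure_union_ne_top (measure_ne_top_of_subset hMK' hfin)
      (volume_strips_Icc_ne_top hk _ _ _ _))).trans (measureReal_union_le _ _)
  -- the area of the new niche
  set E₁ := strips ω (Icc (-η) 0) (Icc (-κ) (k * (w₁ - B) + η * s)) with hE₁
  set E₂ := strips ω (Icc 0 (k * w₂ + κ * s)) (Icc (-κ) 0) with hE₂
  have hN : wallNiche ω Θ η κ (support K) ⊆ wallNiche ω Θ 0 0 (support K) ∪ E₁ ∪ E₂ :=
    hcap.wallNiche_subset hω hΘ hη0.le hκ0 hB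
  have areaN : volume.real (wallNiche ω Θ η κ (support K)) ≤
      volume.real (wallNiche ω Θ 0 0 (support K)) +
        k⁻¹ * (η * (k * (w₁ - B) + η * s + κ)) + k⁻¹ * ((k * w₂ + κ * s) * κ) := by
    have a1 : volume.real E₁ = k⁻¹ * (η * (k * (w₁ - B) + η * s + κ)) := by
      rw [hE₁, volume_strips hk, Real.volume_real_Icc_of_le (by linarith),
        Real.volume_real_Icc_of_le (by
          linarith [mul_nonneg hk.le (sub_nonneg.2 hBw), mul_nonneg hη0.le hs.le])]
      ring
    have a2 : volume.real E₂ = k⁻¹ * ((k * w₂ + κ * s) * κ) := by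
      rw [hE₂, volume_strips hk, Real.volume_real_Icc_of_le (by
          linarith [mul_nonneg hκ0 hs.le]),
        Real.volume_real_Icc_of_le (by linarith)]
      ring
    rw [← a1, ← a2]
    refine (measureReal_mono hN ?_).trans ((measureReal_union_le _ _).trans
      (add_le_add_left (measureReal_union_le _ _) _))
    exact measure_union_ne_top (measure_union_ne_top (volume_wallNiche_ne_top hω hΘ 0 0 _)
      (volume_strips_Icc_ne_top hk _ _ _ _)) (volume_strips_Icc_ne_top hk _ _ _ _)
  -- The terms ηkw₁, ηkB and κkw₂ cancel. What remains is ηe up to second order, contradicting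
  -- maximality.
  have total : k⁻¹ * (η * (k * w₁ - η * s) + κ * (k * w₂ - κ * s - η) -
      η * (k * B - e + c * η) - η * (k * (w₁ - B) + η * s + κ) - (k * w₂ + κ * s) * κ) ≤ 0 := by
    rw [areaR₁, areaR₂] at areaK'
    linarith
  have hneg : η * (k * w₁ - η * s) + κ * (k * w₂ - κ * s - η) -
      η * (k * B - e + c * η) - η * (k * (w₁ - B) + η * s + κ) - (k * w₂ + κ * s) * κ ≤ 0 :=
    nonpos_of_mul_nonpos_right total (inv_pos.2 hk)
  have x1 : κ * κ ≤ η * η := mul_le_mul hκη hκη hκ0 hη0.le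
  have x2 : κ * κ * s ≤ κ * κ := mul_le_of_le_one_right (mul_nonneg hκ0 hκ0) hs1
  have x3 : κ * η ≤ η * η := mul_le_mul_of_nonneg_right hκη hη0.le
  have x4 : η * η * s ≤ η * η := mul_le_of_le_one_right (mul_nonneg hη0.le hη0.le) hs1
  have x5 : η * ((c + 6) * η) ≤ η * (e / 2) := mul_le_mul_of_nonneg_left hηe hη0.le
  have x6 : 0 < η * e := mul_pos hη0 he0
  linarith [mul_pos hη0 hη0]

/-! ### Reflection across the axis of the parallelogram -/

/-- The linear map exchanging `u_t` and `u_{ω + π/2 - t}`. -/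
def axisReflectionAux (ω : ℝ) : Plane →ₗ[ℝ] Plane where
  toFun p := !₂[-Real.sin ω * p 0 + Real.cos ω * p 1, Real.cos ω * p 0 + Real.sin ω * p 1]
  map_add' p q := by ext i; fin_cases i <;> simp <;> ring
  map_smul' c p := by ext i; fin_cases i <;> simp <;> ring

lemma axisReflectionAux_involutive (ω : ℝ) : Function.Involutive (axisReflectionAux ω) := by
  intro p
  have hcs := Real.sin_sq_add_cos_sq ω
  ext i; fin_cases i <;> simp [axisReflectionAux]
  · linear_combination (p 0) * hcs
  · linear_combination (p 1) * hcs

/-- The reflection exchanging `u_t` and `u_{ω + π/2 - t}`. -/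
def axisReflection (ω : ℝ) : Plane ≃ₗᵢ[ℝ] Plane where
  toLinearEquiv := LinearEquiv.ofInvolutive (axisReflectionAux ω) (axisReflectionAux_involutive ω)
  norm_map' p := by
    rw [EuclideanSpace.norm_eq, EuclideanSpace.norm_eq]
    congr 1
    simp [axisReflectionAux, Fin.sum_univ_two]
    linear_combination (p 0 ^ 2 + p 1 ^ 2) * Real.sin_sq_add_cos_sq ω

lemma axisReflection_axisReflection (ω : ℝ) (p : Plane) :
    axisReflection ω (axisReflection ω p) = p := axisReflectionAux_involutive ω p

lemma axisReflection_apply (ω : ℝ) (p : Plane) : axisReflection ω p =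
    !₂[-Real.sin ω * p 0 + Real.cos ω * p 1, Real.cos ω * p 0 + Real.sin ω * p 1] := rfl

lemma proj_axisReflection (ω t : ℝ) (p : Plane) :
    proj t (axisReflection ω p) = proj (ω + Real.pi / 2 - t) p := by
  rw [axisReflection_apply, show ω + Real.pi / 2 - t = (ω - t) + Real.pi / 2 by ring,
    proj_add_pi_div_two, Real.sin_sub, Real.cos_sub]
  simp [proj]; ring

lemma mem_image_axisReflection {ω : ℝ} {S : Set Plane} {p : Plane} :
    p ∈ axisReflection ω '' S ↔ axisReflection ω p ∈ S := by
  constructor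
  · rintro ⟨q, hq, rfl⟩; rwa [axisReflection_axisReflection]
  · intro h; exact ⟨_, h, axisReflection_axisReflection ω p⟩

lemma support_image_axisReflection (ω t : ℝ) (S : Set Plane) :
    support (axisReflection ω '' S) t = support S (ω + Real.pi / 2 - t) := by
  rw [support_eq, support_eq, image_image]
  simp only [proj_axisReflection]

lemma axisReflection_mem_parallelogram {ω : ℝ} {p : Plane} :
    axisReflection ω p ∈ parallelogram ω ↔ p ∈ parallelogram ω := by
  rw [mem_parallelogram, mem_parallelogram, ← proj_pi_div_two, proj_axisReflection,
    proj_axisReflection, add_sub_cancel_right, add_sub_cancel_left, proj_pi_div_two]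
  tauto

lemma axisReflection_mem_fan {ω : ℝ} {p : Plane} :
    axisReflection ω p ∈ fan ω ↔ p ∈ fan ω := by
  rw [mem_fan, mem_fan, ← proj_pi_div_two, proj_axisReflection,
    proj_axisReflection, add_sub_cancel_right, add_sub_cancel_left, proj_pi_div_two]
  tauto

lemma axisReflection_upperVertex {ω : ℝ} (hω : ω ∈ Ioo 0 (Real.pi / 2)) :
    axisReflection ω (upperVertex ω) = upperVertex ω := by
  have h1 := proj_upperVertex_self hω
  have h2 := proj_upperVertex_perp hω
  rw [proj_add_pi_div_two] at h2
  unfold proj at h1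
  rw [axisReflection_apply]
  ext i; fin_cases i
  · simp; rw [show upperVertex ω 0 = Real.tan (Real.pi / 4 - ω / 2) by simp [upperVertex]] at *
    linarith
  · simp; rw [show upperVertex ω 1 = 1 by simp [upperVertex]] at *
    linarith

/-- The hypothesis compares projections instead of angles because the lower sides, at ω + π and
3π/2, correspond only modulo 2π. -/
lemma IsHalfPlaneIntersection.image_axisReflection {ω : ℝ} {A A' : Set ℝ} {K : Set Plane}
    (hA : ∀ a ∈ A, ∃ a' ∈ A', ∀ p, proj a' (axisReflection ω p) = proj a p)
    (h : IsHalfPlaneIntersection A K) : IsHalfPlaneIntersection A' (axisReflection ω '' K) := by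
  obtain ⟨I, hI, rfl⟩ := h
  refine ⟨{j | j.1 ∈ A' ∧ ∃ i ∈ I, (∀ p, proj j.1 (axisReflection ω p) = proj i.1 p) ∧ j.2 = i.2},
    fun j hj => hj.1, ?_⟩
  ext q
  rw [mem_image_axisReflection]
  simp only [mem_iInter₂, mem_halfPlane]
  constructor
  · rintro hq ⟨a, c⟩ ⟨-, i, hi, hp, hc⟩
    have := hq i hi
    simp only at hp hc ⊢
    rwa [← hp, axisReflection_axisReflection, ← hc] at this
  · intro hq i hi
    obtain ⟨a', ha', hp⟩ := hA i.1 (hI i hi)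
    have := hq (a', i.2) ⟨ha', i, hi, hp, rfl⟩
    simp only at this
    rwa [← hp, axisReflection_axisReflection]

lemma IsCap.image_axisReflection {ω : ℝ} {K : Set Plane} (h : IsCap ω K) :
    IsCap ω (axisReflection ω '' K) := by
  obtain ⟨hne, hcpt, hconv, h1, h2, h3, h4, h5⟩ := h
  have per : ∀ t p, proj (t - Real.pi) p = proj (t + Real.pi) p := by
    intro t p
    have := proj_add_pi (t - Real.pi) p
    rw [sub_add_cancel] at this
    rw [proj_add_pi]; linarith
  have per' : ∀ t, support K (t - Real.pi) = support K (t + Real.pi) := by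
    intro t; rw [support_eq, support_eq]; simp only [per]
  refine ⟨hne.image _, hcpt.image (axisReflection ω).continuous,
    hconv.linear_image (axisReflection ω).toLinearEquiv.toLinearMap, ?_, ?_, ?_, ?_,
    h5.image_axisReflection ?_⟩
  · rw [support_image_axisReflection, add_sub_cancel_left, h2]
  · rw [support_image_axisReflection, add_sub_cancel_right, h1]
  · rw [support_image_axisReflection,
      show ω + Real.pi / 2 - (ω + Real.pi) = Real.pi / 2 - Real.pi by ring, per',
      show Real.pi / 2 + Real.pi = 3 * Real.pi / 2 by ring, h4]
  · rw [support_image_axisReflection,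
      show ω + Real.pi / 2 - 3 * Real.pi / 2 = ω - Real.pi by ring, per', h3]
  · have key : ∀ a a' : ℝ, a' = ω + Real.pi / 2 - a →
        ∀ p, proj a' (axisReflection ω p) = proj a p := by
      rintro a a' rfl p; rw [proj_axisReflection]; congr 1; ring
    rintro a ((ha | ha) | ha)
    · exact ⟨ω + Real.pi / 2 - a, Or.inl (Or.inr ⟨by linarith [ha.2], by linarith [ha.1]⟩),
        key _ _ rfl⟩
    · exact ⟨ω + Real.pi / 2 - a, Or.inl (Or.inl ⟨by linarith [ha.2], by linarith [ha.1]⟩),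
        key _ _ rfl⟩
    · rcases ha with rfl | rfl
      · refine ⟨3 * Real.pi / 2, Or.inr (Or.inr rfl), fun p => ?_⟩
        rw [proj_axisReflection, ← per]; congr 1; ring
      · refine ⟨ω + Real.pi, Or.inr (Or.inl rfl), fun p => ?_⟩
        rw [proj_axisReflection,
          show ω + Real.pi / 2 - (ω + Real.pi) = Real.pi / 2 - Real.pi by ring, per]
        congr 1; ring

section Symmetric

variable {ω : ℝ} {Θ : Finset ℝ} {K : Set Plane}

lemma IsPolygonCap.image_axisReflection (hΘ : ∀ t ∈ Θ, ω - t ∈ Θ) (h : IsPolygonCap ω Θ K) :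
    IsPolygonCap ω Θ (axisReflection ω '' K) := by
  refine ⟨h.1.image_axisReflection, h.2.image_axisReflection ?_⟩
  rintro a (((ha | ⟨t, ht, rfl⟩) | ha) | ha)
  · refine ⟨ω - a + Real.pi / 2, Or.inl (Or.inl (Or.inr ⟨ω - a, hΘ a ha, rfl⟩)), fun p => ?_⟩
    rw [proj_axisReflection]; congr 1; ring
  · refine ⟨ω - t, Or.inl (Or.inl (Or.inl (hΘ t ht))), fun p => ?_⟩
    rw [proj_axisReflection]; congr 1; ring
  · rcases ha with rfl | rfl
    · exact ⟨Real.pi / 2, Or.inl (Or.inr (Or.inr rfl)), fun p => by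
        rw [proj_axisReflection, add_sub_cancel_right]⟩
    · exact ⟨ω, Or.inl (Or.inr (Or.inl rfl)), fun p => by
        rw [proj_axisReflection, add_sub_cancel_left]⟩
  · rcases ha with rfl | rfl
    · refine ⟨3 * Real.pi / 2, Or.inr (Or.inr rfl), fun p => ?_⟩
      rw [proj_axisReflection, proj_add_pi,
        show ω + Real.pi / 2 - 3 * Real.pi / 2 = ω - Real.pi by ring]
      have := proj_add_pi (ω - Real.pi) p
      rw [sub_add_cancel] at this
      linarith
    · refine ⟨ω + Real.pi, Or.inr (Or.inl rfl), fun p => ?_⟩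
      rw [proj_axisReflection, proj_three_pi_div_two,
        show ω + Real.pi / 2 - (ω + Real.pi) = -(Real.pi / 2) by ring]
      simp [proj]

lemma polygonArea_image_axisReflection (hΘ : ∀ t ∈ Θ, ω - t ∈ Θ) :
    polygonArea ω Θ (axisReflection ω '' K) = polygonArea ω Θ K := by
  have hp : ∀ (A : Set Plane), volume.real (axisReflection ω ⁻¹' A) = volume.real A := fun A =>
    congrArg ENNReal.toReal ((axisReflection ω).measurePreserving.measure_preimage_emb
      (axisReflection ω).toHomeomorph.measurableEmbedding A)
  have ang : ∀ t : ℝ, ω + Real.pi / 2 - t = ω - t + Real.pi / 2 := fun t => by ring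
  have ang' : ∀ t : ℝ, ω + Real.pi / 2 - (t + Real.pi / 2) = ω - t := fun t => by ring
  have hout : ∀ t p, p ∈ outerQuadrant (axisReflection ω '' K) t ↔
      axisReflection ω p ∈ outerQuadrant K (ω - t) := by
    intro t p
    rw [mem_outerQuadrant, mem_outerQuadrant, support_image_axisReflection,
      support_image_axisReflection, proj_axisReflection, proj_axisReflection, ang, ang',
      show ω + Real.pi / 2 - (ω - t) = t + Real.pi / 2 by ring,
      show ω + Real.pi / 2 - (ω - t + Real.pi / 2) = t by ring]
    exact and_comm
  have hin : ∀ t p, p ∈ innerQuadrant (axisReflection ω '' K) t ↔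
      axisReflection ω p ∈ innerQuadrant K (ω - t) := by
    intro t p
    rw [mem_innerQuadrant, mem_innerQuadrant, support_image_axisReflection,
      support_image_axisReflection, proj_axisReflection, proj_axisReflection, ang, ang',
      show ω + Real.pi / 2 - (ω - t) = t + Real.pi / 2 by ring,
      show ω + Real.pi / 2 - (ω - t + Real.pi / 2) = t by ring]
    exact and_comm
  have e1 : polygonCap ω Θ (axisReflection ω '' K) = axisReflection ω ⁻¹' polygonCap ω Θ K := by
    ext p
    rw [mem_preimage, mem_polygonCap, mem_polygonCap, axisReflection_mem_parallelogram]
    refine and_congr_right fun _ => ⟨fun h t ht => ?_, fun h t ht => (hout t p).2 (h _ (hΘ t ht))⟩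
    have := (hout _ p).1 (h _ (hΘ t ht))
    rwa [sub_sub_cancel] at this
  have e2 : polygonNiche ω Θ (axisReflection ω '' K) =
      axisReflection ω ⁻¹' polygonNiche ω Θ K := by
    ext p
    rw [mem_preimage, mem_polygonNiche, mem_polygonNiche, axisReflection_mem_fan]
    refine and_congr_right fun _ => ⟨fun ⟨t, ht, h⟩ => ⟨_, hΘ t ht, (hin t p).1 h⟩,
      fun ⟨t, ht, h⟩ => ⟨ω - t, hΘ t ht, (hin _ p).2 ?_⟩⟩
    rwa [sub_sub_cancel]
  rw [polygonArea, polygonArea, e1, e2, hp, hp]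

lemma IsMaximumPolygonCap.image_axisReflection (hω : ω ∈ Ioo 0 (Real.pi / 2))
    (hΘ : ∀ t ∈ Θ, ω - t ∈ Θ) (h : IsMaximumPolygonCap ω Θ K) :
    IsMaximumPolygonCap ω Θ (axisReflection ω '' K) := by
  refine ⟨h.1.image_axisReflection hΘ, ?_, fun K' hK' => ?_⟩
  · exact ⟨_, h.2.1, axisReflection_upperVertex hω⟩
  · rw [polygonArea_image_axisReflection hΘ, ← polygonArea_image_axisReflection hΘ (K := K')]
    exact h.2.2 _ (hK'.image_axisReflection hΘ)

end Symmetric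

lemma mem_uniformAngleSet {ω : ℝ} (hω : 0 < ω) {n : ℕ} {t : ℝ} (ht : t ∈ uniformAngleSet ω n) :
    t ∈ Ioo 0 ω ∧ ω - t ∈ uniformAngleSet ω n := by
  simp only [uniformAngleSet, Finset.mem_image, Finset.mem_Ico] at ht ⊢
  obtain ⟨i, ⟨hi1, hin⟩, rfl⟩ := ht
  have hn : (0 : ℝ) < n := by exact_mod_cast (by lia : 0 < n)
  have hi : (0 : ℝ) < i := by exact_mod_cast hi1
  have hin' : (i : ℝ) < n := by exact_mod_cast hin
  refine ⟨⟨by positivity, ?_⟩, n - i, ⟨by lia, by lia⟩, ?_⟩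
  · have : (i : ℝ) / n < 1 := by rwa [div_lt_one hn]
    nlinarith
  · rw [Nat.cast_sub hin.le]; field_simp

lemma IsBalancedMaximumCap.image_axisReflection {ω : ℝ} (hω : ω ∈ Ioo 0 (Real.pi / 2))
    {K : Set Plane} (h : IsBalancedMaximumCap ω K) :
    IsBalancedMaximumCap ω (axisReflection ω '' K) := by
  obtain ⟨hcap, n, P, hn, hn', hP, hlim⟩ := h
  refine ⟨hcap.image_axisReflection, n, fun i => axisReflection ω '' P i, hn, hn', fun i =>
    (hP i).image_axisReflection hω fun t ht => (mem_uniformAngleSet hω.1 ht).2, ?_⟩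
  simpa only [Metric.hausdorffDist_image (axisReflection ω).isometry] using hlim

/-! ### Passing to the limit -/

lemma abs_support_sub_le {P K : Set Plane} (hP : IsCompact P) (hPn : P.Nonempty)
    (hK : IsCompact K) (hKn : K.Nonempty) (t : ℝ) :
    |support P t - support K t| ≤ Metric.hausdorffDist P K := by
  have half : ∀ {A C : Set Plane}, IsCompact A → A.Nonempty → IsCompact C → C.Nonempty →
      support A t ≤ support C t + Metric.hausdorffDist A C := by
    intro A C hA hAn hC hCn
    refine support_le hAn fun p hp => ?_
    obtain ⟨q, hq, hpq⟩ := hC.exists_infDist_eq_dist hCn p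
    have h1 : Metric.infDist p C ≤ Metric.hausdorffDist A C :=
      Metric.infDist_le_hausdorffDist_of_mem hp
        (Metric.hausdorffEDist_ne_top_of_nonempty_of_bounded hAn hCn hA.isBounded hC.isBounded)
    have h2 := proj_le_support hC hq t
    have h3 := (le_abs_self _).trans (abs_proj_le t (p - q))
    rw [proj_sub, ← dist_eq_norm, ← hpq] at h3
    linarith
  have h1 := half hP hPn hK hKn
  have h2 := half hK hKn hP hPn
  rw [Metric.hausdorffDist_comm] at h2
  rw [abs_le]
  constructor <;> linarith

/-- With w = h(0), let y be the height at which the line x = w meets the line p ⋅ u_ω = 1. For t in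
[0, ω] this gives h(t) ≤ w cos t + y sin t, and B cos t + y sin t ≤ 1 by Cauchy-Schwarz. -/
lemma IsCap.support_le_of_sq_add_sq_le {ω B : ℝ} {K : Set Plane} (h : IsCap ω K)
    (hω : ω ∈ Ioo 0 (Real.pi / 2))
    (hB : B ^ 2 + ((1 - support K 0 * Real.cos ω) / Real.sin ω) ^ 2 ≤ 1) {t : ℝ}
    (ht : t ∈ Icc 0 ω) : support K t - 1 ≤ (support K 0 - B) * Real.cos t := by
  have hs := sin_pos_of_mem hω
  set y := (1 - support K 0 * Real.cos ω) / Real.sin ω with hy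
  have hys : y * Real.sin ω = 1 - support K 0 * Real.cos ω := by rw [hy]; field_simp
  have h1 := h.sin_mul_support_le hω ht
  rw [Real.sin_sub] at h1
  have h2 : support K t ≤ support K 0 * Real.cos t + y * Real.sin t := by
    refine le_of_mul_le_mul_left (h1.trans (le_of_eq ?_)) hs
    linear_combination (-Real.sin t) * hys
  have h3 : y * Real.sin t + B * Real.cos t ≤ 1 := by
    nlinarith [sq_nonneg (y * Real.cos t - B * Real.sin t), Real.sin_sq_add_cos_sq t,
      sq_nonneg (y * Real.sin t + B * Real.cos t - 1), sq_nonneg (y - Real.sin t),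
      sq_nonneg (B - Real.cos t)]
  linarith

/-- The conditions on B are strict and involve only h(0), so the approximating polygon caps
eventually satisfy them. The point then lies in those caps, hence in their closed limit. -/
lemma IsBalancedMaximumCap.top_side_mem {ω B : ℝ} (hω : ω ∈ Ioo 0 (Real.pi / 2)) {K : Set Plane}
    (hK : IsBalancedMaximumCap ω K) (hB0 : 0 ≤ B) (hBw : B < support K 0)
    (hB : B ^ 2 + ((1 - support K 0 * Real.cos ω) / Real.sin ω) ^ 2 < 1) :
    (!₂[Real.tan (Real.pi / 4 - ω / 2) - B, 1] : Plane) ∈ K := by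
  obtain ⟨hcap, n, P, -, -, hP, hlim⟩ := hK
  have hw : Tendsto (fun i => support (P i) 0) atTop (𝓝 (support K 0)) := by
    rw [tendsto_iff_dist_tendsto_zero]
    refine squeeze_zero (fun _ => dist_nonneg) (fun i => ?_) hlim
    exact abs_support_sub_le (hP i).1.1.2.1 (hP i).1.1.1 hcap.2.1 hcap.1 0
  have e1 : ∀ᶠ i in atTop, B < support (P i) 0 := hw.eventually_const_lt hBw
  have e2 : ∀ᶠ i in atTop,
      B ^ 2 + ((1 - support (P i) 0 * Real.cos ω) / Real.sin ω) ^ 2 < 1 := by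
    refine Tendsto.eventually_lt_const hB ?_
    exact tendsto_const_nhds.add
      (((tendsto_const_nhds.sub (hw.mul_const _)).div_const _).pow 2)
  set x : Plane := !₂[Real.tan (Real.pi / 4 - ω / 2) - B, 1]
  have hx : ∀ᶠ i in atTop, Metric.infDist x K ≤ Metric.hausdorffDist (P i) K := by
    filter_upwards [e1, e2] with i h1 h2
    have hΘ : ∀ t ∈ uniformAngleSet ω (n i), t ∈ Ioo 0 ω := fun t ht =>
      (mem_uniformAngleSet hω.1 ht).1
    have hm : x ∈ P i := (hP i).top_side_mem hω hΘ hB0 h1.le fun t ht =>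
      (hP i).1.1.support_le_of_sq_add_sq_le hω h2.le ⟨(hΘ t ht).1.le, (hΘ t ht).2.le⟩
    exact Metric.infDist_le_hausdorffDist_of_mem hm
      (Metric.hausdorffEDist_ne_top_of_nonempty_of_bounded (hP i).1.1.1 hcap.1
        (hP i).1.1.2.1.isBounded hcap.2.1.isBounded)
  have hx0 : Metric.infDist x K = 0 :=
    le_antisymm (ge_of_tendsto hlim hx) Metric.infDist_nonneg
  exact (hcap.2.1.isClosed.mem_iff_infDist_zero hcap.1).2 hx0

/-! ### The triangle lies in the niche -/

/-- The intersection of the fan with one inner quadrant is convex, so only the vertices 0, τ(1, 0)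
and τ v_ω need checking; the hypotheses are the binding conditions at the last two. -/
lemma IsCap.triangle_subset_niche {ω t : ℝ} (hω : ω ∈ Ioo 0 (Real.pi / 2)) {K : Set Plane}
    (ht : t ∈ Ioo 0 ω)
    (h1 : 1 + Real.tan (Real.pi / 4 - ω / 2) * Real.cos t < support K t)
    (h2 : 1 + Real.tan (Real.pi / 4 - ω / 2) * Real.cos (ω - t) < support K (t + Real.pi / 2)) :
    triangle ω ⊆ niche ω K := by
  have hτ := tan_pos hω
  obtain ⟨st, ct, sωt, cωt⟩ := trig_pos hω ht
  set τ := Real.tan (Real.pi / 4 - ω / 2) with hτdef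
  have p1 := mul_pos hτ st
  have p2 := mul_pos hτ ct
  have p3 := mul_pos hτ sωt
  have p4 := mul_pos hτ cωt
  have hk := cos_pos_of_mem hω
  set R : Set Plane := {p | 0 ≤ proj ω p ∧ 0 ≤ p 1 ∧ proj t p < support K t - 1 ∧
    proj (t + Real.pi / 2) p < support K (t + Real.pi / 2) - 1} with hR
  have hconv : Convex ℝ R := by
    intro p hp q hq a b ha hb hab
    have e : (a • p + b • q) 1 = a * p 1 + b * q 1 := by simp
    have lt : ∀ {x y c : ℝ}, x < c → y < c → a * x + b * y < c := by
      intro x y c hx hy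
      have := (convex_Iio c) hx hy ha hb hab
      simpa using this
    simp only [hR, mem_ofPred_eq, proj_add, proj_smul, e] at hp hq ⊢
    refine ⟨?_, ?_, lt hp.2.2.1 hq.2.2.1, lt hp.2.2.2 hq.2.2.2⟩
    · have := mul_nonneg ha hp.1; have := mul_nonneg hb hq.1; linarith
    · have := mul_nonneg ha hp.2.1; have := mul_nonneg hb hq.2.1; linarith
  have hsub : triangle ω ⊆ R := by
    refine convexHull_min ?_ hconv
    rw [upperVertex_sub_v, upperVertex_sub_u hω, ← hτdef]
    rintro p (rfl | rfl | rfl)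
    · refine ⟨by simp [proj], by simp, ?_, ?_⟩ <;> rw [proj_origin] <;> linarith
    · refine ⟨by simp [proj]; positivity, by simp, ?_, ?_⟩
      · simp [proj]; linarith
      · rw [proj_add_pi_div_two]; simp; linarith
    · refine ⟨by rw [proj_smul, proj_v]; simp, by simp [v]; positivity, ?_, ?_⟩
      · rw [proj_smul, proj_v, show t - ω = -(ω - t) by ring, Real.sin_neg]; linarith
      · rw [proj_smul, proj_v, show t + Real.pi / 2 - ω = Real.pi / 2 - (ω - t) by ring,
          Real.sin_pi_div_two_sub]
        linarith
  intro p hp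
  obtain ⟨a1, a2, a3, a4⟩ := hsub hp
  exact mem_niche.2 ⟨mem_fan.2 ⟨a1, a2⟩, t, ht, mem_innerQuadrant.2 ⟨a3, a4⟩⟩

/-- First support inequality at t = π/2 - ω. Since w ≥ 1.1, the quadratic area bound weakens to the
linear bound w(2 - 1.1k) ≥ 2.2, and τ(1 + s) = k eliminates τ. -/
lemma width_estimate {k s w τ : ℝ} (hk : 0 < k) (hcs : s ^ 2 + k ^ 2 = 1) (hs1 : s ≤ 1)
    (hs89 : 0.89 ≤ s) (hk2 : k * 2.2 ≤ 1) (hw1 : 1.1 ≤ w) (hw : 2.2 ≤ w * (2 - k * w))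
    (hτk : τ * k = 1 - s) : 1 + τ * s < w * s := by
  have hτs : τ * (1 + s) = k := by
    apply mul_right_cancel₀ hk.ne'
    linear_combination (1 + s) * hτk - hcs
  have h1 : 2.2 ≤ w * (2 - 1.1 * k) := by
    have := mul_le_mul_of_nonneg_right hw1 (by positivity : 0 ≤ k * w)
    linarith
  have h2 : (2 - 1.1 * k) * (1 + s + k * s) < 2.2 * s * (1 + s) := by
    have e : 2.2 * s * (1 + s) - (2 - 1.1 * k) * (1 + s + k * s) =
        k * (1.1 - 0.9 * s) + (2.2 * s ^ 2 + 1.3 * s - 2 - 1.1 * s ^ 3) := by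
      have : k ^ 2 = 1 - s ^ 2 := by linarith
      linear_combination (1.1 * s) * this
    have e1 : 0 ≤ k * (1.1 - 0.9 * s) := mul_nonneg hk.le (by linarith)
    have e2 : 0 < 2.2 * s ^ 2 + 1.3 * s - 2 - 1.1 * s ^ 3 := by
      nlinarith [mul_nonneg (sub_nonneg.2 hs89) (sub_nonneg.2 hs1)]
    linarith
  have h3 : 0 < 2 - 1.1 * k := by linarith
  have h4 : (2 - 1.1 * k) * (1 + s + k * s) < (2 - 1.1 * k) * (w * s * (1 + s)) := by
    have := mul_le_mul_of_nonneg_right h1 (by positivity : 0 ≤ s * (1 + s))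
    linarith
  have h5 := lt_of_mul_lt_mul_left h4 h3.le
  have h6 : (1 + τ * s) * (1 + s) < w * s * (1 + s) := by
    have : (1 + τ * s) * (1 + s) = 1 + s + k * s := by linear_combination s * hτs
    rw [this]; exact h5
  exact lt_of_mul_lt_mul_right h6 (by linarith)

/-- This makes room for some B > 2k with B² + y² < 1. As (1 - wk)² = 1 - kw(2 - kw) ≤ 1 - 2.2k, the
claim reduces to 5k - 4k³ < 2.2, which holds for k ≤ 1/2.2. -/
lemma height_estimate {k s w y : ℝ} (hk : 0 < k) (hcs : s ^ 2 + k ^ 2 = 1) (hs : 0 < s)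
    (hk2 : k * 2.2 ≤ 1) (hw : 2.2 ≤ w * (2 - k * w)) (hys : y * s = 1 - w * k) :
    (2 * k) ^ 2 < 1 - y ^ 2 := by
  have h1 : (y * s) ^ 2 ≤ 1 - 2.2 * k := by
    have := mul_le_mul_of_nonneg_left hw hk.le
    rw [hys]; linarith
  have h3 : 5 * k - 4 * k ^ 3 < 2.2 := by
    nlinarith [mul_nonneg hk.le (sub_nonneg.2 hk2), mul_nonneg hk.le (sq_nonneg (k - 0.4))]
  have h2 : 1 - 2.2 * k < (1 - (2 * k) ^ 2) * s ^ 2 := by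
    have hs2 : s ^ 2 = 1 - k ^ 2 := by linarith
    have := mul_lt_mul_of_pos_left h3 hk
    rw [hs2]
    linarith
  have h3 : y ^ 2 * s ^ 2 < (1 - (2 * k) ^ 2) * s ^ 2 := by rw [← mul_pow]; linarith
  have h4 := lt_of_mul_lt_mul_right h3 (by positivity)
  linarith

/-- A balanced maximum cap that extends far to the right has an inner quadrant containing the
triangle. -/
lemma IsBalancedMaximumCap.exists_angle {ω : ℝ} (hω : ω ∈ Ioo 0 (Real.pi / 2))
    (hk' : Real.cos ω ≤ 1 / 2.2) {K : Set Plane} (hK : IsBalancedMaximumCap ω K)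
    (hw : 2.2 ≤ support K 0 * (2 - Real.cos ω * support K 0)) :
    ∃ t ∈ Ioo 0 ω, 1 + Real.tan (Real.pi / 4 - ω / 2) * Real.cos t < support K t ∧
      1 + Real.tan (Real.pi / 4 - ω / 2) * Real.cos (ω - t) < support K (t + Real.pi / 2) := by
  have hcap := hK.1
  have hk := cos_pos_of_mem hω
  have hs := sin_pos_of_mem hω
  have hcs := Real.sin_sq_add_cos_sq ω
  have hτ := tan_pos hω
  have hτk := tan_mul_cos hω
  have hkw := hcap.cos_mul_support_zero_le hω
  have hpi := Real.pi_pos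
  set k := Real.cos ω with hkdef
  set s := Real.sin ω with hsdef
  set τ := Real.tan (Real.pi / 4 - ω / 2) with hτdef
  set w := support K 0 with hwdef
  have hk2 : k * 2.2 ≤ 1 := by rwa [le_div_iff₀ (by norm_num)] at hk'
  have hw0 : 0 < w := by
    by_contra! hneg
    nlinarith
  have hw1 : 1.1 ≤ w := by nlinarith
  have hkk : k ^ 2 ≤ 25 / 121 := by nlinarith
  have hs89 : 0.89 ≤ s := by nlinarith
  have hs1 : s ≤ 1 := Real.sin_le_one ω
  have hs_lt : s < 1 := by nlinarith
  -- the lower bound for the top side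
  set y := (1 - w * k) / s with hy
  have hys : y * s = 1 - w * k := by rw [hy]; field_simp
  have hy2 : (2 * k) ^ 2 < 1 - y ^ 2 := height_estimate hk hcs hs hk2 hw hys
  set B := (2 * k + min w (Real.sqrt (1 - y ^ 2))) / 2 with hB
  have hm1 : 2 * k < w := by linarith
  have hm2 : 2 * k < Real.sqrt (1 - y ^ 2) := Real.lt_sqrt_of_sq_lt hy2
  have hm3 := lt_min hm1 hm2
  have hBk : 2 * k < B := by rw [hB]; linarith
  have hBm : B < min w (Real.sqrt (1 - y ^ 2)) := by rw [hB]; linarith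
  have hBw : B < w := hBm.trans_le (min_le_left _ _)
  have hBs : B < Real.sqrt (1 - y ^ 2) := hBm.trans_le (min_le_right _ _)
  have hB0 : 0 < B := by linarith
  have hB2 : B ^ 2 < 1 - y ^ 2 := (Real.lt_sqrt hB0.le).1 hBs
  have hmem := hK.top_side_mem hω hB0.le hBw (by rw [← hy]; linarith)
  -- the angle
  have hωq : Real.pi / 4 < ω := by
    by_contra! hle
    have := Real.cos_le_cos_of_nonneg_of_le_pi hω.1.le (by linarith) hle
    rw [Real.cos_pi_div_four] at this
    have h2 : (1.2 : ℝ) < Real.sqrt 2 := Real.lt_sqrt_of_sq_lt (by norm_num)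
    linarith
  have hcu := hcap.support_zero_mul_cos_le hω
    (t := Real.pi / 2 - ω) ⟨by linarith [hω.2], by linarith⟩
  have hsu := proj_le_support hcap.2.1 hmem (Real.pi / 2 - ω + Real.pi / 2)
  rw [proj_add_pi_div_two, Real.sin_pi_div_two_sub, Real.cos_pi_div_two_sub] at hsu
  rw [Real.cos_pi_div_two_sub] at hcu
  refine ⟨Real.pi / 2 - ω, ⟨by linarith [hω.2], by linarith⟩, ?_, ?_⟩
  · rw [Real.cos_pi_div_two_sub]
    exact (width_estimate hk hcs hs1 hs89 hk2 hw1 hw hτk).trans_le hcu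
  · refine lt_of_lt_of_le ?_ hsu
    rw [show ω - (Real.pi / 2 - ω) = -(Real.pi / 2 - 2 * ω) by ring, Real.cos_neg,
      Real.cos_pi_div_two_sub, Real.sin_two_mul, ← hsdef, ← hkdef]
    simp only [Matrix.cons_val_zero, Matrix.cons_val_one]
    -- The point (τ - B, 1) has projection 2s - 1 + Bk, so the inequality becomes Bk > 2 - 2s² =
    -- 2k².
    have e1 : τ * (2 * s * k) = 2 * s * (1 - s) := by linear_combination (2 * s) * hτk
    have e2 : (2 * k) * k < B * k := mul_lt_mul_of_pos_right hBk hk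
    rw [e1]
    linarith

/-! ### The area bound -/

lemma integral_min_add {c : ℝ} (hc : c ∈ Icc 0 1) :
    ∫ y in (0 : ℝ)..1, min 1 (y + c) = 1 - (1 - c) ^ 2 / 2 := by
  have hcont : Continuous fun y : ℝ => min 1 (y + c) := by fun_prop
  rw [← intervalIntegral.integral_add_adjacent_intervals (b := 1 - c)
    (hcont.intervalIntegrable _ _) (hcont.intervalIntegrable _ _)]
  have e1 : ∫ y in (0 : ℝ)..(1 - c), min 1 (y + c) = ∫ y in (0 : ℝ)..(1 - c), (y + c) := by
    refine intervalIntegral.integral_congr fun y hy => ?_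
    rw [uIcc_of_le (by linarith [hc.2])] at hy
    exact min_eq_right (by linarith [hy.2])
  have e2 : ∫ y in (1 - c)..(1 : ℝ), min 1 (y + c) = ∫ y in (1 - c)..(1 : ℝ), (1 : ℝ) := by
    refine intervalIntegral.integral_congr fun y hy => ?_
    rw [uIcc_of_le (by linarith [hc.1])] at hy
    exact min_eq_left (by linarith [hy.1])
  rw [e1, e2, intervalIntegral.integral_add intervalIntegral.intervalIntegrable_id
    intervalIntegrable_const]
  simp
  ring

lemma integral_max_sub {c : ℝ} (hc : c ∈ Icc 0 1) :
    ∫ y in (0 : ℝ)..1, max 0 (y - c) = (1 - c) ^ 2 / 2 := by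
  have hcont : Continuous fun y : ℝ => max 0 (y - c) := by fun_prop
  rw [← intervalIntegral.integral_add_adjacent_intervals (b := c)
    (hcont.intervalIntegrable _ _) (hcont.intervalIntegrable _ _)]
  have e1 : ∫ y in (0 : ℝ)..c, max 0 (y - c) = ∫ y in (0 : ℝ)..c, (0 : ℝ) := by
    refine intervalIntegral.integral_congr fun y hy => ?_
    rw [uIcc_of_le (by linarith [hc.1])] at hy
    exact max_eq_left (by linarith [hy.2])
  have e2 : ∫ y in c..(1 : ℝ), max 0 (y - c) = ∫ y in c..(1 : ℝ), (y - c) := by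
    refine intervalIntegral.integral_congr fun y hy => ?_
    rw [uIcc_of_le (by linarith [hc.2])] at hy
    exact max_eq_right (by linarith [hy.1])
  rw [e1, e2, intervalIntegral.integral_sub intervalIntegral.intervalIntegrable_id
    intervalIntegrable_const]
  simp
  ring

/-- The part of the unit square at small distance from the diagonal. -/
def diagonalBand (c : ℝ) : Set (ℝ × ℝ) :=
  {z | z.1 ∈ Icc (0 : ℝ) 1 ∧ z.2 ∈ Icc (max 0 (z.1 - c)) (min 1 (z.1 + c))}

lemma volume_diagonalBand_le {c : ℝ} (hc : c ∈ Icc 0 1) :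
    volume (diagonalBand c) ≤ ENNReal.ofReal (1 - (1 - c) ^ 2) := by
  have hmeas : MeasurableSet (diagonalBand c) := by
    have : IsClosed (diagonalBand c) := by
      refine (isClosed_Icc.preimage continuous_fst).inter ?_
      exact (isClosed_le (by fun_prop) continuous_snd).inter
        (isClosed_le continuous_snd (by fun_prop))
    exact this.measurableSet
  have hle : ∀ y ∈ Icc (0 : ℝ) 1, max 0 (y - c) ≤ min 1 (y + c) := fun y hy =>
    max_le (le_min zero_le_one (by linarith [hy.1, hc.1]))
      (le_min (by linarith [hy.2, hc.1]) (by linarith [hc.1]))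
  have hcont : Continuous fun y : ℝ => min 1 (y + c) - max 0 (y - c) := by fun_prop
  have hint : ∫ y in Icc (0 : ℝ) 1, (min 1 (y + c) - max 0 (y - c)) = 1 - (1 - c) ^ 2 := by
    rw [integral_Icc_eq_integral_Ioc, ← intervalIntegral.integral_of_le zero_le_one,
      intervalIntegral.integral_sub ((by fun_prop : Continuous fun y : ℝ =>
        min 1 (y + c)).intervalIntegrable _ _) ((by fun_prop : Continuous fun y : ℝ =>
        max 0 (y - c)).intervalIntegrable _ _), integral_min_add hc, integral_max_sub hc]
    ring
  rw [Measure.volume_eq_prod, Measure.prod_apply hmeas, ← hint,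
    ofReal_integral_eq_lintegral_ofReal (hcont.continuousOn.integrableOn_compact isCompact_Icc)
      ((ae_restrict_iff' measurableSet_Icc).2 (ae_of_all _ fun y hy =>
        sub_nonneg.2 (hle y hy))), ← lintegral_indicator measurableSet_Icc]
  refine lintegral_mono fun y => ?_
  by_cases hy : y ∈ Icc (0 : ℝ) 1
  · rw [indicator_of_mem hy, ← Real.volume_Icc]
    exact measure_mono fun z hz => hz.2
  · have : Prod.mk y ⁻¹' diagonalBand c = ∅ := by
      ext z; simp only [mem_preimage, mem_empty_iff_false, iff_false]
      exact fun hz => hy hz.1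
    rw [this, measure_empty]
    exact zero_le

/-- A cap of area at least `2.2` extends far to the right or far to the left. -/
lemma IsCap.exists_large_support {ω : ℝ} (hω : ω ∈ Ioo 0 (Real.pi / 2)) {K : Set Plane}
    (hK : IsCap ω K) (harea : ENNReal.ofReal 2.2 ≤ volume K) {w : ℝ}
    (hw : w = max (support K 0) (support K (ω + Real.pi / 2))) :
    2.2 ≤ w * (2 - Real.cos ω * w) := by
  have hk := cos_pos_of_mem hω
  have hs := sin_pos_of_mem hω
  have hs1 := Real.sin_le_one ω
  have h1 := hK.cos_mul_support_zero_le hω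
  have h2 := hK.cos_mul_support_perp_le hω
  have hkw : Real.cos ω * w ≤ 1 := by
    rcases max_choice (support K 0) (support K (ω + Real.pi / 2)) with h | h <;> rw [hw, h] <;>
      assumption
  -- In the strip coordinates the bounds on p ⋅ u_0 and p ⋅ u_{ω+π/2} keep the two coordinates
  -- within kw of each other, because sin ω ≤ 1. The band has area 1 - (1 - kw)² = kw(2 - kw), and
  -- the Jacobian divides this by k.
  have band : ∀ p ∈ K, (p 1, proj ω p) ∈ diagonalBand (Real.cos ω * w) := by
    intro p hp
    have hpar := mem_parallelogram.1 (hK.subset_parallelogram hp)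
    have a1 : p 0 ≤ w := by
      have := proj_le_support hK.2.1 hp 0
      rw [proj_zero_left] at this
      exact this.trans (hw ▸ le_max_left _ _)
    have a2 : proj (ω + Real.pi / 2) p ≤ w :=
      (proj_le_support hK.2.1 hp _).trans (hw ▸ le_max_right _ _)
    have b1 := mul_le_mul_of_nonneg_left a1 hk.le
    have b2 := mul_le_mul_of_nonneg_left a2 hk.le
    have b3 := mul_le_of_le_one_left hpar.1.1 hs1
    have b4 := mul_le_of_le_one_left hpar.2.1 hs1
    have b5 := coord_one_eq_comb ω p
    refine ⟨hpar.1, max_le hpar.2.1 (by simp only; linarith), le_min hpar.2.2 ?_⟩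
    simp only
    unfold proj at *
    linarith
  have hkw0 : 0 ≤ Real.cos ω * w := by
    obtain ⟨p, hp⟩ := hK.1
    have := band p hp
    have e1 := this.2.1
    have e2 := this.2.2
    have f1 := (le_max_right _ _).trans e1
    have f2 := e2.trans (min_le_right _ _)
    linarith
  have hvol : volume K ≤ ENNReal.ofReal ((Real.cos ω)⁻¹ * (1 - (1 - Real.cos ω * w) ^ 2)) := by
    rw [ENNReal.ofReal_mul (inv_nonneg.2 hk.le)]
    refine (measure_mono (t := {p : Plane | (p 1, proj ω p) ∈ diagonalBand (Real.cos ω * w)})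
      band).trans ?_
    rw [volume_preimage_strips hk]
    gcongr
    exact volume_diagonalBand_le ⟨hkw0, hkw⟩
  have hfin := harea.trans hvol
  rw [ENNReal.ofReal_le_ofReal_iff'] at hfin
  rcases hfin with h | h
  · refine h.trans (le_of_eq ?_)
    field_simp
    ring
  · norm_num at h

/-- Balanced maximum caps are preserved by reflection in the axis of P_ω, since the uniform angle
sets are symmetric under t ↦ ω - t. So the larger of the two extents may be taken on the right. -/
lemma IsBalancedMaximumCap.triangle_subset_niche {ω : ℝ} (hω : ω ∈ Ioo 0 (Real.pi / 2))
    (hk : Real.cos ω ≤ 1 / 2.2) {K : Set Plane} (hK : IsBalancedMaximumCap ω K)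
    (harea : ENNReal.ofReal 2.2 ≤ volume K) : triangle ω ⊆ niche ω K := by
  have hw := hK.1.exists_large_support hω harea rfl
  rcases max_choice (support K 0) (support K (ω + Real.pi / 2)) with h | h
  · rw [h] at hw
    obtain ⟨t, ht, h1, h2⟩ := hK.exists_angle hω hk hw
    exact IsCap.triangle_subset_niche hω ht h1 h2
  · rw [h] at hw
    have hK' := hK.image_axisReflection hω
    have e : support (axisReflection ω '' K) 0 = support K (ω + Real.pi / 2) := by
      rw [support_image_axisReflection, sub_zero]
    obtain ⟨t, ht, h1, h2⟩ := hK'.exists_angle hω hk (by rwa [e])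
    rw [support_image_axisReflection] at h1 h2
    refine IsCap.triangle_subset_niche hω (t := ω - t) ⟨by linarith [ht.2], by linarith [ht.1]⟩
      ?_ ?_
    · rwa [show ω + Real.pi / 2 - (t + Real.pi / 2) = ω - t by ring] at h2
    · rw [sub_sub_cancel]
      rwa [show ω + Real.pi / 2 - t = ω - t + Real.pi / 2 by ring] at h1

lemma rot_zero (p : Plane) : rot 0 p = p := by
  ext i; fin_cases i <;> simp [rot]

end MovingSofa

end

/-! ### Conclusion -/

theorem mainTheorem6 (ω : ℝ) (hω : ω ∈ Set.Icc (Real.arccos (1 / 2.2)) (Real.pi / 2))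
    (S : Set MovingSofa.Plane) (hS : MovingSofa.IsBalancedMaximumSofa ω S)
    (harea : ENNReal.ofReal 2.2 ≤ MeasureTheory.volume S) :
    (∃ φ : ℝ, MovingSofa.IsMovingSofa (MovingSofa.rot φ '' S) (Real.pi / 2)) ∧
    (ω < Real.pi / 2 →
      MovingSofa.triangle ω ⊆ MovingSofa.niche ω (MovingSofa.capOf ω S)) := by
  have hω0 : 0 < ω := (Real.arccos_pos.2 (by norm_num)).trans_le hω.1
  have hω' : ω ∈ Set.Ioc 0 (Real.pi / 2) := ⟨hω0, hω.2⟩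
  have hcos : Real.cos ω ≤ 1 / 2.2 := by
    have := Real.cos_le_cos_of_nonneg_of_le_pi (Real.arccos_nonneg _)
      (by linarith [hω.2, Real.pi_pos]) hω.1
    rwa [Real.cos_arccos (by norm_num) (by norm_num)] at this
  have htri : ω < Real.pi / 2 →
      MovingSofa.triangle ω ⊆ MovingSofa.niche ω (MovingSofa.capOf ω S) := fun hlt =>
    hS.2.triangle_subset_niche ⟨hω0, hlt⟩ hcos
      (harea.trans (MeasureTheory.measure_mono (hS.1.subset_capOf hω')))
  -- No rotation is needed: in standard position `S` already starts in a horizontal strip of width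
  -- 1.
  refine ⟨⟨0, ?_⟩, htri⟩
  simp only [MovingSofa.rot_zero, Set.image_id']
  exact hS.1.isMovingSofa hω' fun hlt => (hS.1.disjoint_niche hω' hS.2.1.1).mono_right (htri hlt)
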